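/- **Setting.** Data points $1,\dots,N$ carry differentiable functions $f_j:\mathbb R^d\to\mathbb R$ and are partitioned into sets $S_1,\dots,S_M$, $M\ge1$. Put $F_m=\frac1{|S_m|}\sum_{j\in S_m}f_j$ and $F=\frac1M\sum_{m=1}^M F_m$. Assume that each $F_m$ is convex with $L_m$-Lipschitz gradient, and that $F$ is $\lambda$-strongly convex ($\lambda>0$) with minimizer $x^*$. Put $\bar L=\frac1M\sum_m L_m$. **Algorithm (ASD-SVRG).** Given $\bar x_0$, step size $\eta>0$, integers $T,R\ge 1$ and sample sizes $1\le n_m\le|S_m|$. In epoch $k$ put $y=\bar x_{k-1}$, $x_0=y$, and for $t=1,\dots,T$ do the following. Independently for each $m$, draw a uniformly random subset $\widetilde S_m\subset S_m$ of size $n_m$ and put $\widetilde w_m=\big\|\frac1{n_m}\sum_{j\in\widetilde S_m}(\nabla f_j(x_{t-1})-\nabla f_j(y))\big\|$, an estimate of $w_m=\|\nabla F_m(x_{t-1})-\nabla F_m(y)\|$. Draw $R$ machines independently with replacement, machine $m$ with probability $\widetilde p_m=\widetilde w_m/\sum_{m'}\widetilde w_{m'}$ (uniformly if all $\widetilde w_m=0$);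 let $H[m]$ be the number of times machine $m$ is drawn, and set $$x_t=x_{t-1}-\eta\sum_{m=1}^M\frac{H[m]}{R}\,v_t^m,\qquad v_t^m=\frac{\nabla F_m(x_{t-1})-\nabla F_m(y)}{M\widetilde p_m}+\nabla F(y)$$ (the fraction is read as $0$ if $\widetilde p_m=0$ or $\widetilde p_m$ is undefined). Finally $\bar x_k$ is chosen uniformly at random from $x_0,\dots,x_{T-1}$. **Constants.** Let either $0<\tau\le\frac15$ and $c=2+5\tau$, or $\tau=\frac13$ and $c=8$. Assume that $\eta$ is so small that $\eta\bar L(\frac cR+1)<1$, and put $$\rho=\frac{1}{\lambda T\eta\,[1-\eta\bar L(\frac cR+1)]}+\frac{c\,\eta\bar L}{R\,[1-\eta\bar L(\frac cR+1)]}.$$ **Sample sizes.** For $\delta\in(0,1)$ say that the sample sizes are *$\delta$-sufficient* if every machine $m$ satisfies (a) or (b): (a) for all $x,y\in\mathbb R^d$ there are vectors $a,b$ with $a\le\nabla f_j(x)-\nabla f_j(y)\le b$ coordinatewise for all $j\in S_m$, and $n_m\|\mu\|^2\ge\frac1{\tau^2}\frac{\|b-a\|^2}{2}\log\frac{2dM}{\delta}$,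 where $\mu=\nabla F_m(x)-\nabla F_m(y)$; (b) $F_m$ is $\lambda_m$-strongly convex with $\lambda_m>0$, the $f_j$, $j\in S_m$, are convex with $l_j$-Lipschitz gradients, and $n_m\ge\frac1{2\tau^2}K_m^2\log\frac{2dM}{\delta}$, where $K_m=\max_{j\in S_m}l_j/\lambda_m$ (for $\tau=\frac13$ this is $n_m\ge\frac92K_m^2\log\frac{2dM}{\delta}$). **Theorem.** Call an inner iteration *accurate* if $|\widetilde w_m-w_m|\le\tau w_m$ for all $m$, and let $\mathcal G_k$ be the event that all inner iterations of the first $k$ epochs are accurate. 1. If the sample sizes are $\delta$-sufficient, then every inner iteration is accurate with probability at least $1-\delta$, conditionally on the past. 2. If the sample sizes are $\frac{\delta}{T}$-sufficient (that is, $\log\frac{2dM}{\delta}$ is replaced by $\log\frac{2dMT}{\delta}$), then, for every starting point of the epoch, all $T$ inner iterations of an epoch are accurate with probability at least $1-\delta$; consequently $\mathbb P(\mathcal G_k)\ge(1-\delta)^k$ for all $k\ge0$. 3. On these events the epochs contract: for all $k\ge1$, $$\mathbb E\big[(F(\bar x_k)-F(x^*))\mathbf 1_{\mathcal G_k}\big]\le\rho\;\mathbb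 E\big[(F(\bar x_{k-1})-F(x^*))\mathbf 1_{\mathcal G_{k-1}}\big].$$ 4. Hence the epoch iterates converge linearly: for all $k\ge 0$, $\mathbb E[(F(\bar x_k)-F(x^*))\mathbf 1_{\mathcal G_k}]\le\rho^k(F(\bar x_0)-F(x^*))$ and $\mathbb E[\|\bar x_k-x^*\|^2\mathbf 1_{\mathcal G_k}]\le\frac2\lambda\rho^k(F(\bar x_0)-F(x^*))$. Here $\rho>0$, and $\rho<1$ whenever $\lambda T\eta\,[1-\eta\bar L(\frac{2c}R+1)]>1$ (that is, for $\eta$ small and then $T$ large). -/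

import Mathlib

open scoped Gradient NNReal ENNReal

namespace ASDSVRG

noncomputable section

/-- The space `ℝ^d` with the Euclidean norm. -/
abbrev Vec (d : ℕ) : Type := EuclideanSpace ℝ (Fin d)

/-- A finite-sum problem distributed over `M` machines: atomic functions `f j`, one for each of the
`N` data points, and the partition of the data points into the local data sets `S m`. -/
structure Problem (d M N : ℕ) where
  f : Fin N → Vec d → ℝ
  S : Fin M → Finset (Fin N)
  disjoint_S : ∀ m m', m ≠ m' → Disjoint (S m) (S m')
  cover_S : ∀ j, ∃ m, j ∈ S m

variable {d M N : ℕ}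

/-- The local objective `F_m(x) = (1 / |S_m|) ∑_{j ∈ S_m} f_j(x)`. -/
def Problem.localObj (P : Problem d M N) (m : Fin M) (x : Vec d) : ℝ :=
  (1 / ((P.S m).card : ℝ)) * ∑ j ∈ P.S m, P.f j x

/-- The global objective `F(x) = (1 / M) ∑_m F_m(x)`. -/
def Problem.obj (P : Problem d M N) (x : Vec d) : ℝ :=
  (1 / (M : ℝ)) * ∑ m, P.localObj m x

/-- The exact weight `w_m = ‖∇F_m(x) - ∇F_m(y)‖` of machine `m`, for the inner iterate `x` and the
epoch's reference point `y`. -/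
def Problem.weight (P : Problem d M N) (x y : Vec d) (m : Fin M) : ℝ≥0 :=
  ‖∇ (P.localObj m) x - ∇ (P.localObj m) y‖₊

/-- The estimated weight `‖(1 / |B|) ∑_{j ∈ B} (∇f_j(x) - ∇f_j(y))‖` from the subsample `B`. -/
def Problem.estWeight (P : Problem d M N) (x y : Vec d) (B : Finset (Fin N)) : ℝ≥0 :=
  ‖(1 / (B.card : ℝ)) • ∑ j ∈ B, (∇ (P.f j) x - ∇ (P.f j) y)‖₊

/-- The event that every machine's weight is estimated with relative error at most `τ` from the
subsamples `B m`. -/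
def Problem.Accurate (P : Problem d M N) (τ : ℝ) (x y : Vec d) (B : Fin M → Finset (Fin N)) :
    Prop :=
  ∀ m, |(P.estWeight x y (B m) : ℝ) - P.weight x y m| ≤ τ * P.weight x y m

/-! ### Sampling -/

/-- Independently for all machines `m`, a uniformly random subset of `S m` of size `n m`. -/
def subsample (P : Problem d M N) (n : Fin M → ℕ) (hn : ∀ m, n m ≤ (P.S m).card) :
    PMF (Fin M → Finset (Fin N)) :=
  PMF.uniformOfFinset (Fintype.piFinset fun m => (P.S m).powersetCard (n m))
    (Fintype.piFinset_nonempty.2 fun m => Finset.powersetCard_nonempty.2 (hn m))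

/-- The categorical distribution with weights `w`: machine `m` has probability `w m / ∑ w`. If all
weights vanish, which happens in particular in the first inner iteration of every epoch, machines
are drawn uniformly (the update does not depend on the draw in that case). -/
def categorical [NeZero M] (w : Fin M → ℝ≥0) : PMF (Fin M) :=
  if h : ∑ m, w m = 0 then PMF.uniformOfFintype (Fin M)
  else PMF.ofFintype (fun m => ((w m / ∑ m', w m' : ℝ≥0) : ℝ≥0∞)) (by
    rw [← ENNReal.ofNNReal_finsetSum, ← Finset.sum_div, div_self h, ENNReal.coe_one])

/-- `R` independent draws (sampling with replacement) from `p`. -/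
def iidDraws (p : PMF (Fin M)) (R : ℕ) : PMF (Fin R → Fin M) :=
  PMF.ofFintype (fun i => ∏ r, p (i r)) (by
    classical
    have h1 : ∑ m, p m = 1 := by rw [← tsum_fintype (L := .unconditional _)]; exact p.tsum_coe
    have h := Finset.prod_univ_sum (fun _ : Fin R => (Finset.univ : Finset (Fin M)))
      (fun _ m => p m)
    rw [Fintype.piFinset_univ] at h
    rw [← h]
    simp [h1])

/-! ### The algorithm -/

/-- The variance-reduced direction of machine `m`,
`v^m = (∇F_m(x) - ∇F_m(y)) / (M p_m) + ∇F(y)` with `p_m = w_m / ∑ w`. -/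
def direction (P : Problem d M N) (w : Fin M → ℝ≥0) (x y : Vec d) (m : Fin M) : Vec d :=
  (1 / ((M : ℝ) * ((w m : ℝ) / ∑ m', (w m' : ℝ)))) •
      (∇ (P.localObj m) x - ∇ (P.localObj m) y) + ∇ P.obj y

/-- The histogram of the drawn machines. -/
def histogram {R : ℕ} (i : Fin R → Fin M) (m : Fin M) : ℕ :=
  (Finset.univ.filter fun r => i r = m).card

/-- The update `x - η ∑_m (H[m] / R) v^m`. -/
def update (P : Problem d M N) (η : ℝ) {R : ℕ} (w : Fin M → ℝ≥0) (x y : Vec d)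
    (i : Fin R → Fin M) : Vec d :=
  x - η • ∑ m, ((histogram i m : ℝ) / (R : ℝ)) • direction P w x y m

/-- One inner iteration from the iterate `x` with reference point `y`: draw the subsamples, form the
estimated weights, draw `R` machines with replacement with probabilities proportional to the
estimated weights, and update. The second component of the result does not influence the algorithm:
it records whether all weight estimates of this iteration have relative error at most `τ`. -/
def innerStep [NeZero M] (P : Problem d M N) (n : Fin M → ℕ) (hn : ∀ m, n m ≤ (P.S m).card)
    (η : ℝ) (R : ℕ) (τ : ℝ) (y x : Vec d) : PMF (Vec d × Prop) :=
  (subsample P n hn).bind fun B =>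
    (iidDraws (categorical fun m => P.estWeight x y (B m)) R).map fun i =>
      (update P η (fun m => P.estWeight x y (B m)) x y i, P.Accurate τ x y B)

/-- The first `t` inner iterations of an epoch with reference point `y`: the trajectory
`x_0 = y, x_1, …, x_t` (the entries after `t` are not used), and whether all weight estimates were
accurate so far. -/
def trajectory [NeZero M] (P : Problem d M N) (n : Fin M → ℕ) (hn : ∀ m, n m ≤ (P.S m).card)
    (η : ℝ) (R : ℕ) (τ : ℝ) (y : Vec d) : ℕ → PMF ((ℕ → Vec d) × Prop)
  | 0 => PMF.pure (fun _ => y, True)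
  | t + 1 => (trajectory P n hn η R τ y t).bind fun s =>
      (innerStep P n hn η R τ y (s.1 t)).map fun u =>
        (Function.update s.1 (t + 1) u.1, s.2 ∧ u.2)

/-- One epoch: run `T` inner iterations from `y` and return an element of `x_0, …, x_{T-1}` whose
index is uniformly random, together with whether all weight estimates of the epoch were accurate. -/
def epoch [NeZero M] (P : Problem d M N) (n : Fin M → ℕ) (hn : ∀ m, n m ≤ (P.S m).card)
    (η : ℝ) (R T : ℕ) [NeZero T] (τ : ℝ) (y : Vec d) : PMF (Vec d × Prop) :=
  (trajectory P n hn η R τ y T).bind fun s =>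
    (PMF.uniformOfFintype (Fin T)).map fun t => (s.1 (t : ℕ), s.2)

/-- The law, after `k` epochs started at `x₀`, of the epoch iterate together with the event that all
weight estimates of these `k` epochs were accurate. -/
def run [NeZero M] (P : Problem d M N) (n : Fin M → ℕ) (hn : ∀ m, n m ≤ (P.S m).card)
    (η : ℝ) (R T : ℕ) [NeZero T] (τ : ℝ) (x₀ : Vec d) : ℕ → PMF (Vec d × Prop)
  | 0 => PMF.pure (x₀, True)
  | k + 1 => (run P n hn η R T τ x₀ k).bind fun s =>
      (epoch P n hn η R T τ s.1).map fun u => (u.1, s.2 ∧ u.2)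

/-! ### Probabilities and expectations -/

/-- The probability of the recorded event. -/
def eventProb (p : PMF (Vec d × Prop)) : ℝ≥0∞ := p.toOuterMeasure {s | s.2}

open Classical in
/-- The expectation `E[g(x) 1_𝓔]`, where `𝓔` is the recorded event, for a nonnegative `g`. -/
def expectOn (p : PMF (Vec d × Prop)) (g : Vec d → ℝ) : ℝ≥0∞ :=
  ∑' s, p s * (if s.2 then ENNReal.ofReal (g s.1) else 0)

/-! ### Sample sizes -/

/-- The condition number `K_m = max_{j ∈ S_m} l_j / λ_m`. -/
def condNumber (P : Problem d M N) (l : Fin N → ℝ≥0) (lam : Fin M → ℝ) (m : Fin M) : ℝ :=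
  ((P.S m).sup l : ℝ≥0) / lam m

/-- Sample size in terms of coordinatewise bounds: for all points `x`, `y`, the vectors
`a_j = ∇f_j(x) - ∇f_j(y)`, `j ∈ S_m`, lie between fixed vectors `a` and `b` and
`n ≥ (1 / τ²) ‖b - a‖² / (2 ‖μ‖²) log(2 d M / δ)`, where `μ` is the mean of the `a_j`. -/
def BoxSampleSize (P : Problem d M N) (τ δ : ℝ) (m : Fin M) (n : ℕ) : Prop :=
  ∀ x y : Vec d, ∃ a b : Vec d,
    (∀ j ∈ P.S m, ∀ i, a i ≤ (∇ (P.f j) x - ∇ (P.f j) y) i ∧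
      (∇ (P.f j) x - ∇ (P.f j) y) i ≤ b i) ∧
    1 / τ ^ 2 * (‖b - a‖ ^ 2 / 2) * Real.log (2 * d * M / δ) ≤ n * (P.weight x y m : ℝ) ^ 2

/-- Sample size in terms of the condition number: `F_m` is `λ_m`-strongly convex, the atomic
functions of machine `m` are convex with `l_j`-Lipschitz gradients, and
`n ≥ (1 / (2 τ²)) K_m² log(2 d M / δ)`. -/
def CondSampleSize (P : Problem d M N) (l : Fin N → ℝ≥0) (lam : Fin M → ℝ) (τ δ : ℝ) (m : Fin M)
    (n : ℕ) : Prop :=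
  0 < lam m ∧ StrongConvexOn Set.univ (lam m) (P.localObj m) ∧
    (∀ j ∈ P.S m, ConvexOn ℝ Set.univ (P.f j) ∧ LipschitzWith (l j) (∇ (P.f j))) ∧
    1 / (2 * τ ^ 2) * condNumber P l lam m ^ 2 * Real.log (2 * d * M / δ) ≤ n

/-- All sample sizes are sufficient, with accuracy `τ` and failure probability `δ`. -/
def SampleSizes (P : Problem d M N) (l : Fin N → ℝ≥0) (lam : Fin M → ℝ) (τ δ : ℝ)
    (n : Fin M → ℕ) : Prop :=
  ∀ m, BoxSampleSize P τ δ m (n m) ∨ CondSampleSize P l lam τ δ m (n m)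

/-! ### The rate -/

/-- The average `(1 / M) ∑_m L_m` of the Lipschitz constants. -/
def avgLip (L : Fin M → ℝ≥0) : ℝ := (1 / (M : ℝ)) * ∑ m, (L m : ℝ)

/-- `ρ = 1 / (λ T η [1 - η L̄ (c / R + 1)]) + c η L̄ / (R [1 - η L̄ (c / R + 1)])`. -/
def rate (lamF η Lbar c : ℝ) (R T : ℕ) : ℝ :=
  1 / (lamF * T * η * (1 - η * Lbar * (c / R + 1))) +
    c * η * Lbar / (R * (1 - η * Lbar * (c / R + 1)))

end

end ASDSVRG

/-! Two arguments are combined: a concentration estimate for the sampled weights, and a contraction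
estimate valid whenever the weights are accurate.

Accuracy. By the reverse triangle inequality it suffices that the subsample mean of the vectors
`∇f_j(x) - ∇f_j(y)` deviates from the full mean by at most `τ w_m`. Under (a) these vectors lie in
the ball circumscribed about a box. Under (b) cocoercivity puts them in a ball of radius
proportional to `‖x - y‖`, while strong convexity gives `w_m ≥ λ_m ‖x - y‖`. Either way a Hoeffding
inequality in Hilbert space for sampling without replacement applies
(`card_filter_powersetCard_le`). It is proved with the test function `cosh (θ ‖·‖)`: one centered
draw from a ball of radius `r` raises its mean at most by the factor `exp (θ² r² / 2)`
(`sum_cosh_norm_add_le`), and midpoint convexity compares draws without and with replacement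
(`sum_powersetCard_succ_le`). No dimension enters, so the `d` inside the logarithm is slack. A union
bound handles the machines; products of conditional probabilities handle iterations and epochs.

Contraction. With accurate weights the drawn directions are unbiased, with variance at most `(1 + τ)
/ (1 - τ)` times the squared average weight (`exists_categorical_eq`). Cauchy-Schwarz between the
`L_m` and the Bregman divergences at the minimizer bounds that square by suboptimality gaps, with
the average `L̄` instead of the maximum (`avg_norm_gradient_sub_sq_le`). Expanding `‖x_t - x*‖²` and
telescoping over an epoch bounds the mean gap of its iterates; strong convexity turns the initial
squared distance into a gap. Inaccurate outcomes contribute zero to `E[· 1_𝒢]`, so the conditional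
estimates chain through the indicators. -/

namespace ASDSVRG

/-! ### Convexity, smoothness and cocoercivity in a Hilbert space. -/

section Gradients

variable {E : Type*} [NormedAddCommGroup E] [InnerProductSpace ℝ E] [CompleteSpace E]

lemma hasDerivAt_comp_line {f : E → ℝ} (hf : Differentiable ℝ f) (x v : E) (t : ℝ) :
    HasDerivAt (fun t : ℝ => f (x + t • v)) (inner ℝ (∇ f (x + t • v)) v) t := by
  have h1 : HasDerivAt (fun t : ℝ => x + t • v) v t := by
    simpa using ((hasDerivAt_id t).smul_const v).const_add x
  have h2 := (hf (x + t • v)).hasGradientAt.hasFDerivAt.comp_hasDerivAt t h1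
  simpa [Function.comp_def] using h2

lemma inner_gradient_le_sub_of_convexOn {f : E → ℝ} (hf : Differentiable ℝ f)
    (hc : ConvexOn ℝ Set.univ f) (x y : E) : inner ℝ (∇ f x) (y - x) ≤ f y - f x := by
  have hg : ConvexOn ℝ Set.univ (fun t : ℝ => f (x + t • (y - x))) := by
    have := hc.comp_affineMap (AffineMap.lineMap x y)
    simpa [Function.comp_def, AffineMap.lineMap_apply, add_comm] using this
  have h := hg.le_slope_of_hasDerivAt (Set.mem_univ 0) (Set.mem_univ 1) one_pos
    (hasDerivAt_comp_line hf x (y - x) 0)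
  simpa [slope_def_field] using h

/-- The first order condition for strong convexity. -/
lemma inner_gradient_add_le_of_strongConvexOn {f : E → ℝ} (hf : Differentiable ℝ f) {m : ℝ}
    (hc : StrongConvexOn Set.univ m f) (x y : E) :
    inner ℝ (∇ f x) (y - x) + m / 2 * ‖y - x‖ ^ 2 ≤ f y - f x := by
  have hg : ConvexOn ℝ Set.univ (fun t : ℝ => f (x + t • (y - x)) -
      m / 2 * ‖x + t • (y - x)‖ ^ 2) := by
    have := (strongConvexOn_iff_convex.1 hc).comp_affineMap (AffineMap.lineMap x y)
    simpa [Function.comp_def, AffineMap.lineMap_apply, add_comm] using this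
  have hline : HasDerivAt (fun t : ℝ => x + t • (y - x)) (y - x) 0 := by
    simpa using ((hasDerivAt_id (0 : ℝ)).smul_const (y - x)).const_add x
  have h := hg.le_slope_of_hasDerivAt (Set.mem_univ 0) (Set.mem_univ 1) one_pos
    ((hasDerivAt_comp_line hf x (y - x) 0).sub (hline.norm_sq.const_mul (m / 2)))
  simp only [zero_smul, add_zero, slope_def_field, one_smul, sub_zero, div_one,
    add_sub_cancel] at h
  have e : ‖y‖ ^ 2 = ‖x‖ ^ 2 + 2 * inner ℝ x (y - x) + ‖y - x‖ ^ 2 := by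
    rw [← norm_add_sq_real, add_sub_cancel]
  rw [e] at h
  linarith

lemma gradient_eq_zero_of_forall_le {f : E → ℝ} {x : E} (h : ∀ y, f x ≤ f y) : ∇ f x = 0 := by
  have : IsLocalMin f x := Filter.Eventually.of_forall h
  simp [gradient, this.fderiv_eq_zero]

lemma norm_sub_sq_le_of_strongConvexOn {f : E → ℝ} (hf : Differentiable ℝ f) {m : ℝ} (hm : 0 < m)
    (hc : StrongConvexOn Set.univ m f) {x : E} (h : ∀ y, f x ≤ f y) (y : E) :
    ‖y - x‖ ^ 2 ≤ 2 / m * (f y - f x) := by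
  have h1 := inner_gradient_add_le_of_strongConvexOn hf hc x y
  rw [gradient_eq_zero_of_forall_le h, inner_zero_left, zero_add] at h1
  calc ‖y - x‖ ^ 2 = 2 / m * (m / 2 * ‖y - x‖ ^ 2) := by field_simp
    _ ≤ _ := by gcongr

/-- Adding the first order conditions at the two points gives strong monotonicity of the gradient;
Cauchy-Schwarz then cancels one factor `‖x - y‖`. This bounds the exact weights from below under the
condition-number hypothesis. -/
lemma mul_norm_sub_le_of_strongConvexOn {f : E → ℝ} (hf : Differentiable ℝ f) {m : ℝ}
    (hc : StrongConvexOn Set.univ m f) (x y : E) : m * ‖x - y‖ ≤ ‖∇ f x - ∇ f y‖ := by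
  have h1 := inner_gradient_add_le_of_strongConvexOn hf hc x y
  have h2 := inner_gradient_add_le_of_strongConvexOn hf hc y x
  have e : inner ℝ (∇ f x) (y - x) = - inner ℝ (∇ f x) (x - y) := by
    rw [← inner_neg_right, neg_sub]
  rw [e, norm_sub_rev] at h1
  have h3 : m * ‖x - y‖ ^ 2 ≤ ‖∇ f x - ∇ f y‖ * ‖x - y‖ := by
    refine le_trans ?_ (real_inner_le_norm _ _)
    rw [inner_sub_left]
    linarith
  rcases (norm_nonneg (x - y)).eq_or_lt with h0 | h0
  · rw [← h0]; simp
  · rw [sq, ← mul_assoc] at h3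
    exact le_of_mul_le_mul_right h3 h0

/-- The descent lemma for functions with Lipschitz gradient. -/
lemma sub_le_inner_gradient_add {f : E → ℝ} (hf : Differentiable ℝ f) {K : ℝ≥0}
    (hK : LipschitzWith K (∇ f)) (x v : E) :
    f (x + v) - f x ≤ inner ℝ (∇ f x) v + K / 2 * ‖v‖ ^ 2 := by
  set g : ℝ → ℝ := fun t => f (x + t • v) - t * inner ℝ (∇ f x) v - t ^ 2 * (K / 2 * ‖v‖ ^ 2)
    with hgdef
  have hg : ∀ t, HasDerivAt g (inner ℝ (∇ f (x + t • v)) v - inner ℝ (∇ f x) v -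
      2 * t * (K / 2 * ‖v‖ ^ 2)) t := fun t => by
    have h := ((hasDerivAt_comp_line hf x v t).sub
      ((hasDerivAt_id t).mul_const (inner ℝ (∇ f x) v))).sub
      ((hasDerivAt_pow 2 t).mul_const (K / 2 * ‖v‖ ^ 2))
    exact (show HasDerivAt g _ t from h).congr_deriv (by simp)
  -- The quadratic term in `g` is chosen so that the Lipschitz bound makes the derivative
  -- nonpositive on the unit interval.
  have hanti : AntitoneOn g (Set.Icc 0 1) := by
    refine antitoneOn_of_deriv_nonpos (convex_Icc 0 1)
      (fun t _ => (hg t).continuousAt.continuousWithinAt)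
      (fun t _ => (hg t).differentiableAt.differentiableWithinAt) fun t ht => ?_
    rw [interior_Icc] at ht
    rw [(hg t).deriv, ← inner_sub_left]
    have h1 := real_inner_le_norm (∇ f (x + t • v) - ∇ f x) v
    have h2 := hK.norm_sub_le (x + t • v) x
    rw [add_sub_cancel_left, norm_smul, Real.norm_of_nonneg ht.1.le] at h2
    have h3 := mul_le_mul_of_nonneg_right h2 (norm_nonneg v)
    nlinarith
  have h := hanti (Set.left_mem_Icc.2 zero_le_one) (Set.right_mem_Icc.2 zero_le_one) zero_le_one
  simp only [hgdef, one_smul, zero_smul, add_zero] at h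
  linarith

/-- For convex functions with Lipschitz gradient, the Bregman divergence controls the difference of
the gradients. -/
lemma norm_gradient_sub_sq_le {f : E → ℝ} (hf : Differentiable ℝ f)
    (hc : ConvexOn ℝ Set.univ f) {K : ℝ≥0} (hK : LipschitzWith K (∇ f)) (x z : E) :
    ‖∇ f x - ∇ f z‖ ^ 2 ≤ 2 * K * (f x - f z - inner ℝ (∇ f z) (x - z)) := by
  set g := ∇ f x - ∇ f z with hg
  rcases eq_or_ne K 0 with h0 | h0
  · subst h0
    have h := hK.norm_sub_le x z
    rw [NNReal.coe_zero, zero_mul] at h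
    rw [le_antisymm h (norm_nonneg _)]
    simp
  have hKpos : (0 : ℝ) < K := by positivity
  -- The function `f - ⟨∇f z, ·⟩` is minimal at `z`; it is compared with its value after a gradient
  -- step of length `1 / K` from `x`.
  have h1 := sub_le_inner_gradient_add hf hK x (-(K : ℝ)⁻¹ • g)
  have h2 := inner_gradient_le_sub_of_convexOn hf hc z (x + -(K : ℝ)⁻¹ • g)
  have e : inner ℝ (∇ f z) (x + -(K : ℝ)⁻¹ • g - z) =
      inner ℝ (∇ f z) (x - z) - (K : ℝ)⁻¹ * inner ℝ (∇ f z) g := by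
    rw [add_sub_right_comm, inner_add_right, inner_smul_right]
    ring
  have e2 : ‖g‖ ^ 2 = inner ℝ (∇ f x) g - inner ℝ (∇ f z) g := by
    rw [← inner_sub_left, real_inner_self_eq_norm_sq]
  rw [e] at h2
  rw [inner_smul_right, norm_smul, mul_pow, norm_neg, Real.norm_eq_abs, sq_abs] at h1
  have h3 : (K : ℝ)⁻¹ * ‖g‖ ^ 2 - (K : ℝ) / 2 * ((K : ℝ)⁻¹ ^ 2 * ‖g‖ ^ 2) ≤
      f x - f z - inner ℝ (∇ f z) (x - z) := by
    nth_rewrite 1 [e2]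
    linarith
  have h4 : (K : ℝ)⁻¹ * ‖g‖ ^ 2 - (K : ℝ) / 2 * ((K : ℝ)⁻¹ ^ 2 * ‖g‖ ^ 2) = ‖g‖ ^ 2 / (2 * K) := by
    field_simp
    ring
  rw [h4, div_le_iff₀ (by positivity)] at h3
  linarith

/-- Gradients of convex functions with Lipschitz gradient are cocoercive. -/
lemma norm_gradient_sub_sq_le_inner {f : E → ℝ} (hf : Differentiable ℝ f)
    (hc : ConvexOn ℝ Set.univ f) {K : ℝ≥0} (hK : LipschitzWith K (∇ f)) (x y : E) :
    ‖∇ f x - ∇ f y‖ ^ 2 ≤ K * inner ℝ (∇ f x - ∇ f y) (x - y) := by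
  have h1 := norm_gradient_sub_sq_le hf hc hK x y
  have h2 := norm_gradient_sub_sq_le hf hc hK y x
  have e : inner ℝ (∇ f x) (y - x) = - inner ℝ (∇ f x) (x - y) := by
    rw [← inner_neg_right, neg_sub]
  rw [e, norm_sub_rev] at h2
  rw [inner_sub_left]
  linarith

/-- Differences of gradients of a convex function with Lipschitz gradient lie in a ball of
radius `K / 2 * ‖x - y‖`. -/
lemma norm_gradient_sub_sub_le {f : E → ℝ} (hf : Differentiable ℝ f)
    (hc : ConvexOn ℝ Set.univ f) {K : ℝ≥0} (hK : LipschitzWith K (∇ f)) (x y : E) :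
    ‖∇ f x - ∇ f y - ((K : ℝ) / 2) • (x - y)‖ ≤ K / 2 * ‖x - y‖ := by
  -- After squaring, the terms `(K / 2)² ‖x - y‖²` cancel and cocoercivity remains.
  refine le_of_sq_le_sq ?_ (by positivity)
  rw [norm_sub_sq_real, inner_smul_right, norm_smul, Real.norm_of_nonneg (by positivity)]
  have h := norm_gradient_sub_sq_le_inner hf hc hK x y
  linarith

end Gradients

/-! ### Hoeffding's inequality in Hilbert space, without replacement. -/

section Hoeffding

-- The power series of `cosh` contains only even powers with positive coefficients, so `cosh t` is a
-- monotone convex function of `t ^ 2`; the inequality is checked term by term.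
open Real in
lemma cosh_le_of_sq_le {t a b p : ℝ} (hp0 : 0 ≤ p) (hp1 : p ≤ 1)
    (h : t ^ 2 ≤ (1 - p) * a ^ 2 + p * b ^ 2) :
    cosh t ≤ (1 - p) * cosh a + p * cosh b := by
  refine hasSum_le (fun k => ?_) (Real.hasSum_cosh t)
    (((Real.hasSum_cosh a).mul_left (1 - p)).add ((Real.hasSum_cosh b).mul_left p))
  rw [← mul_div_assoc, ← mul_div_assoc, ← add_div]
  gcongr
  rw [pow_mul, pow_mul, pow_mul]
  refine (pow_le_pow_left₀ (sq_nonneg t) h k).trans ?_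
  have := (convexOn_pow k).2 (x := a ^ 2) (Set.mem_Ici.2 (sq_nonneg a)) (y := b ^ 2)
    (Set.mem_Ici.2 (sq_nonneg b)) (sub_nonneg.2 hp1) hp0 (by ring)
  simpa [smul_eq_mul] using this

open MeasureTheory ProbabilityTheory in
/-- Hoeffding's lemma for a distribution on `{-1, 1}` with mean `q`. -/
lemma cosh_add_mul_sinh_le {q : ℝ} (hq : |q| ≤ 1) (x : ℝ) :
    Real.cosh x + q * Real.sinh x ≤ Real.exp (q * x + x ^ 2 / 2) := by
  obtain ⟨hq1, hq2⟩ := abs_le.1 hq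
  -- The law on `{-1, 1}` with mean `q`: its moment generating function is the left-hand side, and
  -- its range has half-width `1`.
  set μ : Measure ℝ := ENNReal.ofReal ((1 + q) / 2) • Measure.dirac 1 +
    ENNReal.ofReal ((1 - q) / 2) • Measure.dirac (-1) with hμ
  have hp : IsProbabilityMeasure μ := ⟨by
    simp only [hμ, Measure.add_apply, Measure.smul_apply, measure_univ, smul_eq_mul, mul_one]
    rw [← ENNReal.ofReal_add (by linarith) (by linarith)]
    ring_nf
    simp⟩
  have hint : ∀ g : ℝ → ℝ, ∫ ω, g ω ∂μ = (1 + q) / 2 * g 1 + (1 - q) / 2 * g (-1) := fun g => by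
    rw [hμ, integral_add_measure, integral_smul_measure, integral_smul_measure, integral_dirac,
      integral_dirac, ENNReal.toReal_ofReal (by linarith), ENNReal.toReal_ofReal (by linarith),
      smul_eq_mul, smul_eq_mul]
    · exact (integrable_dirac (by simp)).smul_measure ENNReal.ofReal_ne_top
    · exact (integrable_dirac (by simp)).smul_measure ENNReal.ofReal_ne_top
  have hmem : ∀ᵐ ω ∂μ, id ω ∈ Set.Icc (-1 : ℝ) 1 := by
    rw [hμ, ae_add_measure_iff]
    constructor <;> refine Measure.ae_smul_measure ?_ _ <;> rw [ae_dirac_eq] <;> simp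
  have h := (hasSubgaussianMGF_of_mem_Icc aemeasurable_id hmem).mgf_le x
  rw [mgf, hint, hint] at h
  have e1 : (((‖(1 : ℝ) - -1‖₊ / 2) ^ 2 : ℝ≥0) : ℝ) = 1 := by
    push_cast
    norm_num
  rw [e1] at h
  simp only [id] at h
  have e2 : Real.exp (x * (1 - ((1 + q) / 2 * 1 + (1 - q) / 2 * -1))) =
      Real.exp x * Real.exp (-(q * x)) := by
    rw [← Real.exp_add]; ring_nf
  have e3 : Real.exp (x * (-1 - ((1 + q) / 2 * 1 + (1 - q) / 2 * -1))) =
      Real.exp (-x) * Real.exp (-(q * x)) := by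
    rw [← Real.exp_add]; ring_nf
  rw [e2, e3] at h
  have h2 := mul_le_mul_of_nonneg_right h (Real.exp_pos (q * x)).le
  have e4 : Real.exp (-(q * x)) * Real.exp (q * x) = 1 := by
    rw [← Real.exp_add]; simp
  rw [← Real.exp_add (1 * x ^ 2 / 2)] at h2
  calc Real.cosh x + q * Real.sinh x
      = ((1 + q) / 2 * Real.exp x + (1 - q) / 2 * Real.exp (-x)) *
        (Real.exp (-(q * x)) * Real.exp (q * x)) := by
        rw [e4, Real.cosh_eq, Real.sinh_eq]; ring
    _ ≤ Real.exp (1 * x ^ 2 / 2 + q * x) := by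
        refine le_trans (le_of_eq ?_) h2
        ring
    _ = _ := by ring_nf

/-- The left side is the average of `exp u * (cosh v + q sinh v)` and `exp (-u) * (cosh v - q sinh
v)`; the two-point bound is used for `q` and for `-q`. -/
lemma cosh_mul_cosh_add_le {q : ℝ} (hq : |q| ≤ 1) (u v : ℝ) :
    Real.cosh u * Real.cosh v + q * (Real.sinh u * Real.sinh v) ≤
      Real.exp (v ^ 2 / 2) * Real.cosh (u + q * v) := by
  have h1 := cosh_add_mul_sinh_le hq v
  have h2 := cosh_add_mul_sinh_le (q := -q) (by rwa [abs_neg]) v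
  have h1' := mul_le_mul_of_nonneg_left h1 (Real.exp_pos u).le
  have h2' := mul_le_mul_of_nonneg_left h2 (Real.exp_pos (-u)).le
  rw [Real.exp_add] at h1' h2'
  rw [Real.cosh_eq (u + q * v), Real.exp_add, neg_add, Real.exp_add, Real.cosh_eq u,
    Real.sinh_eq u, ← neg_mul]
  linarith

variable {E : Type*} [NormedAddCommGroup E] [InnerProductSpace ℝ E] {ι : Type*}

/-- This midpoint convexity is the only property of the test function needed to compare sampling
without and with replacement. -/
lemma two_mul_cosh_norm_le (θ : ℝ) (v u : E) :
    2 * Real.cosh (θ * ‖v‖) ≤ Real.cosh (θ * ‖v + u‖) + Real.cosh (θ * ‖v - u‖) := by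
  set a := θ * ‖v + u‖
  set b := θ * ‖v - u‖
  have hab : Real.cosh a + Real.cosh b = 2 * Real.cosh ((a + b) / 2) * Real.cosh ((a - b) / 2) := by
    have ha : a = (a + b) / 2 + (a - b) / 2 := by ring
    have hb : b = (a + b) / 2 - (a - b) / 2 := by ring
    calc Real.cosh a + Real.cosh b
        = Real.cosh ((a + b) / 2 + (a - b) / 2) + Real.cosh ((a + b) / 2 - (a - b) / 2) := by
          rw [← ha, ← hb]
      _ = _ := by rw [Real.cosh_add, Real.cosh_sub]; ring
  have h1 : Real.cosh (θ * ‖v‖) ≤ Real.cosh ((a + b) / 2) := by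
    rw [Real.cosh_le_cosh, ← mul_add, mul_div_assoc, abs_mul, abs_mul, abs_norm,
      abs_of_nonneg (a := (‖v + u‖ + ‖v - u‖) / 2) (by positivity)]
    gcongr
    have h := norm_add_le (v + u) (v - u)
    have e : v + u + (v - u) = v + v := by abel
    have h3 : ‖v + v‖ = 2 * ‖v‖ := by
      rw [← two_smul ℝ v, norm_smul, Real.norm_ofNat]
    rw [e, h3] at h
    linarith
  rw [hab]
  have h2 := Real.one_le_cosh ((a - b) / 2)
  have h3 := Real.cosh_pos ((a + b) / 2)
  nlinarith


/-- One step of the Hilbert space Hoeffding inequality: adding a centered random vector from a ball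
of radius `r` (with arbitrary centre) increases `cosh (θ ‖·‖)` at most by the factor
`exp (θ² r² / 2)` in the mean. -/
lemma sum_cosh_norm_add_le (S : Finset ι) (D : ι → E) (hD : ∑ j ∈ S, D j = 0) {e : E} {r : ℝ}
    (hr : 0 < r) (hball : ∀ j ∈ S, ‖D j - e‖ ≤ r) (θ : ℝ) (s : E) :
    ∑ j ∈ S, Real.cosh (θ * ‖s + D j‖) ≤
      S.card * (Real.exp ((θ * r) ^ 2 / 2) * Real.cosh (θ * ‖s‖)) := by
  -- Recentering: `s + D j` is `w` plus a vector of norm at most `r`. The case `w = 0` is separate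
  -- because the direction of `w` is used below.
  set w := s + e with hw
  have hsD : ∀ j, s + D j = w + (D j - e) := fun j => by rw [hw]; abel
  have hexp : 1 ≤ Real.exp ((θ * r) ^ 2 / 2) := Real.one_le_exp (by positivity)
  rcases (norm_nonneg w).eq_or_lt with hA | hA
  · have hw0 : w = 0 := norm_eq_zero.1 hA.symm
    rw [← nsmul_eq_mul]
    refine Finset.sum_le_card_nsmul _ _ _ fun j hj => ?_
    have h1 : Real.cosh (θ * ‖s + D j‖) ≤ Real.cosh (θ * r) := by
      rw [hsD, hw0, zero_add, Real.cosh_le_cosh, abs_mul, abs_mul, abs_norm, abs_of_pos hr]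
      gcongr
      exact hball j hj
    have h2 := Real.cosh_le_exp_half_sq (θ * r)
    have h3 := Real.one_le_cosh (θ * ‖s‖)
    nlinarith
  · set A := ‖w‖ with hAdef
    rcases S.eq_empty_or_nonempty with rfl | hS
    · simp
    have hcard : (0 : ℝ) < S.card := by exact_mod_cast hS.card_pos
    have hz : ∀ j ∈ S, |inner ℝ w (D j - e) / (A * r)| ≤ 1 := fun j hj => by
      rw [abs_div, abs_of_pos (mul_pos hA hr), div_le_one (mul_pos hA hr)]
      refine (abs_real_inner_le_norm _ _).trans ?_
      gcongr
      exact hball j hj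
    have hpt : ∀ j ∈ S, Real.cosh (θ * ‖s + D j‖) ≤ Real.cosh (θ * A) * Real.cosh (θ * r) +
        inner ℝ w (D j - e) / (A * r) * (Real.sinh (θ * A) * Real.sinh (θ * r)) := fun j hj => by
      obtain ⟨h1, h2⟩ := abs_le.1 (hz j hj)
      set q := inner ℝ w (D j - e) / (A * r) with hq
      have hqe : inner ℝ w (D j - e) = q * (A * r) := by
        rw [hq, div_mul_cancel₀ _ (mul_pos hA hr).ne']
      -- Writing `⟨w, D j - e⟩ = q A r`, one has `‖s + D j‖² ≤ A² + 2 q A r + r²`, which is the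
      -- mixture of `(A - r)²` and `(A + r)²` with weight `p = (1 + q) / 2`.
      have h := cosh_le_of_sq_le (t := θ * ‖s + D j‖) (a := θ * A - θ * r) (b := θ * A + θ * r)
        (p := (1 + q) / 2) (by linarith) (by linarith) (by
          rw [hsD, mul_pow, norm_add_sq_real, hqe]
          have h3 : ‖D j - e‖ ^ 2 ≤ r ^ 2 := pow_le_pow_left₀ (norm_nonneg _) (hball j hj) 2
          have h4 := mul_le_mul_of_nonneg_left h3 (sq_nonneg θ)
          rw [← hAdef]
          linarith)
      rw [Real.cosh_add, Real.cosh_sub] at h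
      linarith
    refine (Finset.sum_le_sum hpt).trans ?_
    rw [Finset.sum_add_distrib, Finset.sum_const, ← Finset.sum_mul, ← Finset.sum_div, ← inner_sum,
      Finset.sum_sub_distrib, hD, zero_sub, Finset.sum_const, inner_neg_right,
      ← Nat.cast_smul_eq_nsmul ℝ S.card e, inner_smul_right, nsmul_eq_mul]
    -- Because the `D j` sum to zero, this is the average of the individual values of `q`.
    set q := -(inner ℝ w e / (A * r)) with hq
    have hqabs : |q| ≤ 1 := by
      have h1 : ∑ j ∈ S, inner ℝ w (D j - e) / (A * r) = S.card * q := by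
        rw [← Finset.sum_div, ← inner_sum, Finset.sum_sub_distrib, hD, zero_sub, Finset.sum_const,
          inner_neg_right, ← Nat.cast_smul_eq_nsmul ℝ S.card e, inner_smul_right, hq]
        ring
      have h2 : |(S.card : ℝ) * q| ≤ S.card := by
        rw [← h1]
        refine (Finset.abs_sum_le_sum_abs _ _).trans ?_
        simpa using Finset.sum_le_card_nsmul _ _ 1 hz
      rw [abs_mul, Nat.abs_cast] at h2
      exact le_of_mul_le_mul_left (by simpa using h2) hcard
    have hmain := cosh_mul_cosh_add_le hqabs (θ * A) (θ * r)
    have hlast : Real.cosh (θ * A + q * (θ * r)) ≤ Real.cosh (θ * ‖s‖) := by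
      -- The average drift undoes the recentering: `A - ⟨w, e⟩ / A = ⟨w, s⟩ / A`, so the arbitrary
      -- centre of the ball costs nothing.
      have h1 : θ * A + q * (θ * r) = θ * (inner ℝ w s / A) := by
        have h2 : s = w - e := by rw [hw]; abel
        rw [h2, inner_sub_right, real_inner_self_eq_norm_sq, ← hAdef, hq]
        field_simp
        ring
      rw [h1, Real.cosh_le_cosh, abs_mul, abs_mul, abs_norm, abs_div, abs_of_pos hA]
      gcongr
      rw [div_le_iff₀ hA, mul_comm]
      exact abs_real_inner_le_norm _ _
    have h5 := mul_le_mul_of_nonneg_left hlast (Real.exp_pos ((θ * r) ^ 2 / 2)).le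
    have h6 := mul_le_mul_of_nonneg_left (hmain.trans h5) hcard.le
    refine le_trans (le_of_eq ?_) h6
    rw [hq]
    ring

variable [DecidableEq ι]

/-- Double counting: a set with an outside point corresponds to a one larger set with a marked
point. -/
lemma sum_powersetCard_sum_sdiff_insert {β : Type*} [AddCommMonoid β] (S : Finset ι) (n : ℕ)
    (h : Finset ι → ι → β) :
    ∑ B ∈ S.powersetCard n, ∑ j ∈ S \ B, h (insert j B) j =
      ∑ C ∈ S.powersetCard (n + 1), ∑ j ∈ C, h C j := by
  rw [Finset.sum_sigma', Finset.sum_sigma']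
  refine Finset.sum_bij' (fun a _ => ⟨insert a.2 a.1, a.2⟩) (fun a _ => ⟨a.1.erase a.2, a.2⟩)
    ?_ ?_ ?_ ?_ ?_
  · rintro ⟨B, j⟩ hj
    simp only [Finset.mem_sigma, Finset.mem_powersetCard, Finset.mem_sdiff] at hj ⊢
    exact ⟨⟨Finset.insert_subset hj.2.1 hj.1.1, by
      rw [Finset.card_insert_of_notMem hj.2.2, hj.1.2]⟩, Finset.mem_insert_self _ _⟩
  · rintro ⟨C, j⟩ hj
    simp only [Finset.mem_sigma, Finset.mem_powersetCard, Finset.mem_sdiff] at hj ⊢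
    exact ⟨⟨(Finset.erase_subset _ _).trans hj.1.1, by
      rw [Finset.card_erase_of_mem hj.2, hj.1.2, Nat.add_sub_cancel]⟩, hj.1.1 hj.2,
      Finset.notMem_erase _ _⟩
  · rintro ⟨B, j⟩ hj
    simp only [Finset.mem_sigma, Finset.mem_sdiff] at hj
    simp [Finset.erase_insert hj.2.2]
  · rintro ⟨C, j⟩ hj
    simp only [Finset.mem_sigma] at hj
    simp [Finset.insert_erase hj.2]
  · rintro ⟨B, j⟩ _
    rfl

/-- Hoeffding's comparison of sampling without and with replacement, for one additional draw. -/
lemma sum_powersetCard_succ_le {V : Type*} [AddCommGroup V] (S : Finset ι) (D : ι → V)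
    (φ : V → ℝ)
    (hφ : ∀ v u, 2 * φ v ≤ φ (v + u) + φ (v - u)) {n : ℕ} (hn : n ≤ S.card) :
    ((n : ℝ) + 1) * S.card * ∑ C ∈ S.powersetCard (n + 1), φ (∑ j ∈ C, D j) ≤
      ((S.card : ℝ) - n) * ∑ B ∈ S.powersetCard n, ∑ i ∈ S, φ (∑ j ∈ B, D j + D i) := by
  set Q := ∑ C ∈ S.powersetCard (n + 1), φ (∑ j ∈ C, D j) with hQ
  -- The extra draw `i` is either fresh or repeats an element of `B`. Fresh draws reproduce every
  -- `C` exactly `n + 1` times.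
  have hsplit : ∑ B ∈ S.powersetCard n, ∑ i ∈ S, φ (∑ j ∈ B, D j + D i) =
      ∑ B ∈ S.powersetCard n, ∑ i ∈ S \ B, φ (∑ j ∈ B, D j + D i) +
      ∑ B ∈ S.powersetCard n, ∑ i ∈ B, φ (∑ j ∈ B, D j + D i) := by
    rw [← Finset.sum_add_distrib]
    refine Finset.sum_congr rfl fun B hB => ?_
    rw [Finset.sum_sdiff (Finset.mem_powersetCard.1 hB).1]
  have h1 : ∑ B ∈ S.powersetCard n, ∑ i ∈ S \ B, φ (∑ j ∈ B, D j + D i) = (n + 1) * Q := by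
    have h := sum_powersetCard_sum_sdiff_insert S n (fun C _ => φ (∑ j ∈ C, D j))
    rw [hQ, Finset.mul_sum]
    refine Eq.trans ?_ (h.trans ?_)
    · refine Finset.sum_congr rfl fun B _ => Finset.sum_congr rfl fun i hi => ?_
      rw [Finset.sum_insert (Finset.mem_sdiff.1 hi).2, add_comm]
    · refine Finset.sum_congr rfl fun C hC => ?_
      rw [Finset.sum_const, (Finset.mem_powersetCard.1 hC).2, nsmul_eq_mul]
      push_cast
      ring
  -- For a repeated draw, adding `D i` to the sum over `B` equals replacing some `j ∉ B` by a second
  -- copy of `i` in `insert j B`. The factor `S.card - n` supplies the sum over `j`.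
  have h2 : ((n : ℝ) + 1) * n * Q ≤
      ((S.card : ℝ) - n) * ∑ B ∈ S.powersetCard n, ∑ i ∈ B, φ (∑ j ∈ B, D j + D i) := by
    have h := sum_powersetCard_sum_sdiff_insert S n
      (fun C j => ∑ i ∈ C.erase j, φ (∑ k ∈ C, D k + (D i - D j)))
    have hl : ((S.card : ℝ) - n) * ∑ B ∈ S.powersetCard n, ∑ i ∈ B, φ (∑ j ∈ B, D j + D i) =
        ∑ B ∈ S.powersetCard n, ∑ j ∈ S \ B, ∑ i ∈ (insert j B).erase j,
          φ (∑ k ∈ insert j B, D k + (D i - D j)) := by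
      rw [Finset.mul_sum]
      refine Finset.sum_congr rfl fun B hB => ?_
      obtain ⟨hB1, hB2⟩ := Finset.mem_powersetCard.1 hB
      rw [Finset.sum_congr (s₁ := S \ B) rfl (g := fun _ => ∑ i ∈ B, φ (∑ j ∈ B, D j + D i)),
        Finset.sum_const, Finset.card_sdiff_of_subset hB1, hB2, nsmul_eq_mul, Nat.cast_sub hn]
      intro j hj
      have hjB := (Finset.mem_sdiff.1 hj).2
      rw [Finset.erase_insert hjB, Finset.sum_insert hjB]
      refine Finset.sum_congr rfl fun i _ => congrArg φ ?_
      abel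
    rw [hl, h, hQ, Finset.mul_sum]
    refine Finset.sum_le_sum fun C hC => ?_
    obtain ⟨hC1, hC2⟩ := Finset.mem_powersetCard.1 hC
    set s := ∑ k ∈ C, D k
    have e1 : ∑ j ∈ C, ∑ i ∈ C.erase j, φ (s + (D i - D j)) =
        ∑ j ∈ C, ∑ i ∈ C, φ (s + (D i - D j)) - (n + 1) * φ s := by
      rw [eq_sub_iff_add_eq]
      have : ((n : ℝ) + 1) * φ s = ∑ j ∈ C, φ (s + (D j - D j)) := by
        simp [hC2]
      rw [this, ← Finset.sum_add_distrib]
      refine Finset.sum_congr rfl fun j hj => ?_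
      rw [Finset.sum_erase_add _ _ hj]
    -- Exchanging `i` and `j` reverses the perturbation `D i - D j`, so midpoint convexity applies
    -- pairwise. Removing the diagonal leaves `(n + 1)² - (n + 1) = n (n + 1)` copies of `φ s`.
    have e2 : ((n : ℝ) + 1) ^ 2 * φ s ≤ ∑ j ∈ C, ∑ i ∈ C, φ (s + (D i - D j)) := by
      have h3 : ∑ j ∈ C, ∑ i ∈ C, φ (s + (D i - D j)) = ∑ j ∈ C, ∑ i ∈ C, φ (s - (D i - D j)) := by
        rw [Finset.sum_comm]
        refine Finset.sum_congr rfl fun j _ => Finset.sum_congr rfl fun i _ => congrArg φ ?_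
        abel
      have h4 : ∑ j ∈ C, ∑ i ∈ C, (2 * φ s) ≤ ∑ j ∈ C, ∑ i ∈ C, φ (s + (D i - D j)) +
          ∑ j ∈ C, ∑ i ∈ C, φ (s - (D i - D j)) := by
        rw [← Finset.sum_add_distrib]
        refine Finset.sum_le_sum fun j _ => ?_
        rw [← Finset.sum_add_distrib]
        exact Finset.sum_le_sum fun i _ => hφ _ _
      rw [← h3] at h4
      simp only [Finset.sum_const, hC2, nsmul_eq_mul] at h4
      push_cast at h4
      linarith
    rw [e1]
    linarith
  rw [hsplit, h1, mul_add]
  linarith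

lemma sum_powersetCard_cosh_le (S : Finset ι) (D : ι → E) (hD : ∑ j ∈ S, D j = 0) {e : E} {r : ℝ}
    (hr : 0 < r) (hball : ∀ j ∈ S, ‖D j - e‖ ≤ r) (θ : ℝ) {n : ℕ} (hn : n ≤ S.card) :
    ∑ B ∈ S.powersetCard n, Real.cosh (θ * ‖∑ j ∈ B, D j‖) ≤
      S.card.choose n * Real.exp (n * ((θ * r) ^ 2 / 2)) := by
  induction n with
  | zero => simp
  | succ n ih =>
    have hn' : n ≤ S.card := n.le_succ.trans hn
    have hN : (0 : ℝ) < S.card := by exact_mod_cast n.succ_pos.trans_le hn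
    have hd : (0 : ℝ) ≤ (S.card : ℝ) - n := sub_nonneg.2 (by exact_mod_cast hn')
    set κ := (θ * r) ^ 2 / 2
    set Q := ∑ B ∈ S.powersetCard n, Real.cosh (θ * ‖∑ j ∈ B, D j‖) with hQ
    have h1 := sum_powersetCard_succ_le S D (fun v => Real.cosh (θ * ‖v‖))
      (two_mul_cosh_norm_le θ) hn'
    have h2 : ∑ B ∈ S.powersetCard n, ∑ i ∈ S, Real.cosh (θ * ‖∑ j ∈ B, D j + D i‖) ≤
        S.card * Real.exp κ * Q := by
      rw [hQ, Finset.mul_sum]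
      refine Finset.sum_le_sum fun B _ => ?_
      rw [mul_assoc]
      exact sum_cosh_norm_add_le S D hD hr hball θ _
    have h3 := h1.trans (mul_le_mul_of_nonneg_left (h2.trans
      (mul_le_mul_of_nonneg_left (ih hn') (by positivity))) hd)
    have hch : (S.card.choose (n + 1) : ℝ) * (n + 1) = S.card.choose n * ((S.card : ℝ) - n) := by
      have := Nat.choose_succ_right_eq S.card n
      rw [← Nat.cast_sub hn']
      exact_mod_cast this
    have h4 : Real.exp (((n + 1 : ℕ) : ℝ) * κ) = Real.exp κ * Real.exp (n * κ) := by
      rw [← Real.exp_add]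
      push_cast
      ring_nf
    rw [h4]
    refine le_of_mul_le_mul_left (h3.trans (le_of_eq ?_))
      (show (0 : ℝ) < ((n : ℝ) + 1) * S.card by positivity)
    linear_combination -(S.card * Real.exp κ * Real.exp (n * κ)) * hch

/-- Hoeffding's inequality in a Hilbert space for sampling without replacement: if the vectors `a j`
lie in a ball of radius `r`, then among the subsets of size `n` at most the fraction
`2 exp (-n s² / (2 r²))` has a mean that deviates from the mean of all vectors by more than `s`. -/
theorem card_filter_powersetCard_le (S : Finset ι) (a : ι → E) {μ e : E}
    (hμ : ∑ j ∈ S, (a j - μ) = 0) {r : ℝ} (hr : 0 < r) (hball : ∀ j ∈ S, ‖a j - e‖ ≤ r)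
    {n : ℕ} (hnpos : 0 < n) (hn : n ≤ S.card) {s : ℝ} (hs : 0 ≤ s)
    (bad : Finset ι → Prop) [DecidablePred bad]
    (hbad : ∀ B ∈ S.powersetCard n, bad B → s ≤ ‖(1 / (n : ℝ)) • ∑ j ∈ B, a j - μ‖) :
    (((S.powersetCard n).filter bad).card : ℝ) ≤
      S.card.choose n * (2 * Real.exp (-(n * s ^ 2 / (2 * r ^ 2)))) := by
  have hn0 : (0 : ℝ) < n := by exact_mod_cast hnpos
  -- The minimizer of the Chernoff exponent `n (θ² r² / 2 - θ s)`. The factor `2` in the result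
  -- comes from `cosh t ≥ exp t / 2`.
  set θ := s / r ^ 2 with hθ
  have hθ0 : 0 ≤ θ := by positivity
  have h := sum_powersetCard_cosh_le S (fun j => a j - μ) hμ (e := e - μ) hr
    (fun j hj => by simpa using hball j hj) θ hn
  have h1 : (((S.powersetCard n).filter bad).card : ℝ) * (Real.exp (θ * (n * s)) / 2) ≤
      ∑ B ∈ S.powersetCard n, Real.cosh (θ * ‖∑ j ∈ B, (a j - μ)‖) := by
    refine le_trans ?_ (Finset.sum_le_sum_of_subset_of_nonneg (Finset.filter_subset bad _)
      fun _ _ _ => (Real.cosh_pos _).le)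
    rw [← nsmul_eq_mul]
    refine Finset.card_nsmul_le_sum _ _ _ fun B hB => ?_
    obtain ⟨hB, hb⟩ := Finset.mem_filter.1 hB
    have h2 : ∑ j ∈ B, (a j - μ) = (n : ℝ) • ((1 / (n : ℝ)) • ∑ j ∈ B, a j - μ) := by
      rw [smul_sub, smul_smul, mul_one_div_cancel hn0.ne', one_smul, Finset.sum_sub_distrib,
        Finset.sum_const, (Finset.mem_powersetCard.1 hB).2, Nat.cast_smul_eq_nsmul]
    rw [h2, norm_smul, Real.norm_of_nonneg hn0.le, Real.cosh_eq]
    have h3 : Real.exp (θ * (n * s)) ≤ Real.exp (θ * (n * ‖(1 / (n : ℝ)) • ∑ j ∈ B, a j - μ‖)) := by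
      gcongr
      exact hbad B hB hb
    have h4 := Real.exp_pos (-(θ * (n * ‖(1 / (n : ℝ)) • ∑ j ∈ B, a j - μ‖)))
    linarith
  have h2 := h1.trans h
  have e1 : Real.exp (n * ((θ * r) ^ 2 / 2)) =
      Real.exp (-(n * s ^ 2 / (2 * r ^ 2))) * Real.exp (θ * (n * s)) := by
    rw [← Real.exp_add]
    congr 1
    rw [hθ]
    field_simp
    ring
  rw [e1] at h2
  refine le_of_mul_le_mul_right (a := Real.exp (θ * (n * s)) / 2) (h2.trans (le_of_eq ?_))
    (by positivity)
  ring

end Hoeffding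

/-! ### Gradients of the local and global objectives. -/

section Gradients

variable {E : Type*} [NormedAddCommGroup E] [InnerProductSpace ℝ E] [CompleteSpace E]

lemma hasGradientAt_const_mul_sum {ι : Type*} (s : Finset ι) {f : ι → E → ℝ}
    (hf : ∀ j ∈ s, Differentiable ℝ (f j)) (c : ℝ) (x : E) :
    HasGradientAt (fun x => c * ∑ j ∈ s, f j x) (c • ∑ j ∈ s, ∇ (f j) x) x := by
  rw [hasGradientAt_iff_hasFDerivAt]
  have h := (HasFDerivAt.fun_sum fun j hj => (hf j hj x).hasGradientAt.hasFDerivAt).const_mul c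
  simpa [map_sum] using h

end Gradients

variable {d M N : ℕ}

lemma Problem.hasGradientAt_localObj (P : Problem d M N) (hf : ∀ j, Differentiable ℝ (P.f j))
    (m : Fin M) (x : Vec d) : HasGradientAt (P.localObj m)
      ((1 / ((P.S m).card : ℝ)) • ∑ j ∈ P.S m, ∇ (P.f j) x) x :=
  hasGradientAt_const_mul_sum _ (fun j _ => hf j) _ _

lemma Problem.differentiable_localObj (P : Problem d M N) (hf : ∀ j, Differentiable ℝ (P.f j))
    (m : Fin M) : Differentiable ℝ (P.localObj m) :=
  fun x => (P.hasGradientAt_localObj hf m x).differentiableAt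

lemma Problem.gradient_localObj_sub (P : Problem d M N) (hf : ∀ j, Differentiable ℝ (P.f j))
    (m : Fin M) (x y : Vec d) : ∇ (P.localObj m) x - ∇ (P.localObj m) y =
      (1 / ((P.S m).card : ℝ)) • ∑ j ∈ P.S m, (∇ (P.f j) x - ∇ (P.f j) y) := by
  rw [(P.hasGradientAt_localObj hf m x).gradient, (P.hasGradientAt_localObj hf m y).gradient,
    ← smul_sub, Finset.sum_sub_distrib]

lemma Problem.hasGradientAt_obj (P : Problem d M N) (hf : ∀ j, Differentiable ℝ (P.f j))
    (x : Vec d) : HasGradientAt P.obj ((1 / (M : ℝ)) • ∑ m, ∇ (P.localObj m) x) x :=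
  hasGradientAt_const_mul_sum _ (fun m _ => P.differentiable_localObj hf m) _ _

lemma Problem.differentiable_obj (P : Problem d M N) (hf : ∀ j, Differentiable ℝ (P.f j)) :
    Differentiable ℝ P.obj :=
  fun x => (P.hasGradientAt_obj hf x).differentiableAt

/-! ### From the sample size conditions to a failure fraction per machine. -/

section SampleSizes

lemma norm_le_norm_of_forall_abs_le {u v : Vec d} (h : ∀ i, |u i| ≤ |v i|) : ‖u‖ ≤ ‖v‖ := by
  rw [EuclideanSpace.norm_eq, EuclideanSpace.norm_eq]
  refine Real.sqrt_le_sqrt (Finset.sum_le_sum fun i _ => ?_)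
  rw [Real.norm_eq_abs, Real.norm_eq_abs]
  exact pow_le_pow_left₀ (abs_nonneg _) (h i) 2

/-- Under either sample size condition the gradient differences of a machine lie in a ball whose
radius is small compared with the exact weight. -/
lemma exists_ball_of_sampleSize (P : Problem d M N) (hf : ∀ j, Differentiable ℝ (P.f j))
    {l : Fin N → ℝ≥0} {lam : Fin M → ℝ} {τ δ : ℝ} (hτ : 0 < τ) {m : Fin M} {n : ℕ}
    (h : BoxSampleSize P τ δ m n ∨ CondSampleSize P l lam τ δ m n) (x y : Vec d) :
    ∃ (e : Vec d) (r : ℝ), 0 ≤ r ∧ (∀ j ∈ P.S m, ‖∇ (P.f j) x - ∇ (P.f j) y - e‖ ≤ r) ∧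
      2 * r ^ 2 * Real.log (2 * d * M / δ) ≤ n * (τ * (P.weight x y m : ℝ)) ^ 2 := by
  set Lg := Real.log (2 * d * M / δ)
  rcases h with h | ⟨hlam, hstr, hj, hn⟩
  · obtain ⟨a, b, hab, hn⟩ := h x y
    refine ⟨(1 / 2 : ℝ) • (a + b), ‖b - a‖ / 2, by positivity, fun j hj => ?_, ?_⟩
    · have h1 : ‖∇ (P.f j) x - ∇ (P.f j) y - (1 / 2 : ℝ) • (a + b)‖ ≤ ‖(1 / 2 : ℝ) • (b - a)‖ := by
        refine norm_le_norm_of_forall_abs_le fun i => ?_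
        obtain ⟨h1, h2⟩ := hab j hj i
        refine le_trans ?_ (le_abs_self _)
        rw [PiLp.sub_apply, abs_le]
        simp only [PiLp.smul_apply, PiLp.add_apply, PiLp.sub_apply (x := b), smul_eq_mul]
        constructor <;> linarith
      refine h1.trans (le_of_eq ?_)
      rw [norm_smul, Real.norm_of_nonneg (by norm_num)]
      ring
    · have h2 := mul_le_mul_of_nonneg_left hn (sq_nonneg τ)
      have e1 : τ ^ 2 * (1 / τ ^ 2 * (‖b - a‖ ^ 2 / 2) * Lg) = 2 * (‖b - a‖ / 2) ^ 2 * Lg := by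
        field_simp
      rw [e1] at h2
      linarith
  · set K := (P.S m).sup l with hK
    -- Cocoercivity gives radius `K / 2 * ‖x - y‖` instead of `K * ‖x - y‖`; this is the source of
    -- the constant `1 / (2 τ²)`.
    refine ⟨((K : ℝ) / 2) • (x - y), K / 2 * ‖x - y‖, by positivity, fun j hjS => ?_, ?_⟩
    · exact norm_gradient_sub_sub_le (hf j) (hj j hjS).1
        ((hj j hjS).2.weaken (Finset.le_sup (f := l) hjS)) x y
    · have h1 : lam m * ‖x - y‖ ≤ P.weight x y m :=
        mul_norm_sub_le_of_strongConvexOn (P.differentiable_localObj hf m) hstr x y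
      have h2 : (lam m * ‖x - y‖) ^ 2 ≤ (P.weight x y m : ℝ) ^ 2 :=
        pow_le_pow_left₀ (by positivity) h1 2
      have h3 := mul_le_mul_of_nonneg_right hn (sq_nonneg (τ * (lam m * ‖x - y‖)))
      have e1 : 1 / (2 * τ ^ 2) * condNumber P l lam m ^ 2 * Lg * (τ * (lam m * ‖x - y‖)) ^ 2 =
          2 * (K / 2 * ‖x - y‖) ^ 2 * Lg := by
        rw [condNumber, ← hK]
        field_simp
      rw [e1] at h3
      refine h3.trans ?_
      rw [mul_pow, mul_pow τ]
      gcongr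

/-- On a machine with sufficient sample size at most the fraction `δ / M` of the subsamples gives an
inaccurate weight. -/
lemma card_filter_inaccurate_le [NeZero M] (P : Problem d M N)
    (hf : ∀ j, Differentiable ℝ (P.f j)) {l : Fin N → ℝ≥0} {lam : Fin M → ℝ} {τ δ : ℝ}
    (hτ : 0 < τ) (hδ0 : 0 < δ) (hδ1 : δ < 1) {m : Fin M} {n : ℕ} (hnpos : 0 < n)
    (hn : n ≤ (P.S m).card) (h : BoxSampleSize P τ δ m n ∨ CondSampleSize P l lam τ δ m n)
    (x y : Vec d) (bad : Finset (Fin N) → Prop) [DecidablePred bad]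
    (hbad : ∀ B, bad B →
      τ * (P.weight x y m : ℝ) < |(P.estWeight x y B : ℝ) - P.weight x y m|) :
    ((((P.S m).powersetCard n).filter bad).card : ℝ) ≤ (P.S m).card.choose n * (δ / M) := by
  have hM : (1 : ℝ) ≤ M := by exact_mod_cast NeZero.one_le
  have hnone : (∀ B ∈ (P.S m).powersetCard n, ¬ bad B) →
      ((((P.S m).powersetCard n).filter bad).card : ℝ) ≤ (P.S m).card.choose n * (δ / M) := by
    intro h0
    rw [Finset.filter_false_of_mem h0]
    simp only [Finset.card_empty, Nat.cast_zero]
    positivity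
  -- For `d = 0` the logarithm is `log 0 = 0` and the size condition is void, but all weights
  -- vanish.
  rcases Nat.eq_zero_or_pos d with hd | hd
  · subst hd
    refine hnone fun B _ hB => (hbad B hB).not_ge ?_
    have hz : ∀ v : Vec 0, v = 0 := fun v => Subsingleton.elim _ _
    simp [Problem.weight, Problem.estWeight, hz]
  have hd1 : (1 : ℝ) ≤ d := by exact_mod_cast hd
  have hdM : (1 : ℝ) ≤ d * M := one_le_mul_of_one_le_of_one_le hd1 hM
  have hlog : 0 < Real.log (2 * d * M / δ) := by
    refine Real.log_pos ?_
    rw [one_lt_div hδ0]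
    linarith
  obtain ⟨e, r, hr, hball, hsize⟩ := exists_ball_of_sampleSize P hf hτ h x y
  set a : Fin N → Vec d := fun j => ∇ (P.f j) x - ∇ (P.f j) y with ha
  set μ := ∇ (P.localObj m) x - ∇ (P.localObj m) y with hμ
  have hS : (0 : ℝ) < (P.S m).card := by exact_mod_cast hnpos.trans_le hn
  have hsum : ∑ j ∈ P.S m, (a j - μ) = 0 := by
    rw [Finset.sum_sub_distrib, Finset.sum_const, hμ, P.gradient_localObj_sub hf,
      ← Nat.cast_smul_eq_nsmul ℝ, smul_smul, mul_one_div_cancel hS.ne', one_smul, sub_self]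
  have hw : (P.weight x y m : ℝ) = ‖μ‖ := rfl
  have hdev : ∀ B ∈ (P.S m).powersetCard n, bad B →
      τ * ‖μ‖ < ‖(1 / (n : ℝ)) • ∑ j ∈ B, a j - μ‖ := fun B hB hb => by
    refine (hbad B hb).trans_le ?_
    have h1 := abs_norm_sub_norm_le ((1 / (n : ℝ)) • ∑ j ∈ B, a j) μ
    rwa [← (Finset.mem_powersetCard.1 hB).2] at h1 ⊢
  rcases hr.eq_or_lt with hr0 | hr0
  -- Radius zero: all gradient differences coincide, so every subsample mean is exact.
  · refine hnone fun B hB hb => (hdev B hB hb).not_ge ?_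
    have hae : ∀ j ∈ P.S m, a j = e := fun j hj =>
      sub_eq_zero.1 (norm_le_zero_iff.1 ((hball j hj).trans_eq hr0.symm))
    have hμe : e = μ := by
      rw [Finset.sum_congr rfl fun j hj => by rw [hae j hj], Finset.sum_const,
        ← Nat.cast_smul_eq_nsmul ℝ, smul_eq_zero] at hsum
      exact sub_eq_zero.1 (hsum.resolve_left hS.ne')
    obtain ⟨hB1, hB2⟩ := Finset.mem_powersetCard.1 hB
    have hn0 : (n : ℝ) ≠ 0 := by exact_mod_cast hnpos.ne'
    rw [Finset.sum_congr rfl fun j hj => hae j (hB1 hj), Finset.sum_const, hB2,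
      ← Nat.cast_smul_eq_nsmul ℝ, smul_smul, one_div_mul_cancel hn0, one_smul, hμe, sub_self,
      norm_zero]
    positivity
  · refine (card_filter_powersetCard_le (P.S m) a hsum hr0 hball hnpos hn
      (s := τ * ‖μ‖) (by positivity) bad fun B hB hb => (hdev B hB hb).le).trans ?_
    gcongr
    have h1 : Real.log (2 * d * M / δ) ≤ n * (τ * ‖μ‖) ^ 2 / (2 * r ^ 2) := by
      rw [le_div_iff₀ (by positivity), mul_comm]
      exact hsize
    calc 2 * Real.exp (-(n * (τ * ‖μ‖) ^ 2 / (2 * r ^ 2)))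
        ≤ 2 * Real.exp (-Real.log (2 * d * M / δ)) := by gcongr
      _ = δ / (d * M) := by
          rw [Real.exp_neg, Real.exp_log (by positivity)]
          field_simp
      _ ≤ δ / M := by
          gcongr
          exact le_mul_of_one_le_left (by positivity) hd1

end SampleSizes

/-! ### Union bound over the machines. -/

section Union

variable {α : Type*} {M : ℕ}

/-- The union bound for products of uniform distributions. -/
lemma one_sub_mul_prod_card_le [NeZero M] [DecidableEq α] (t : Fin M → Finset α)
    (good : Fin M → α → Prop) [∀ m, DecidablePred (good m)] {δ : ℝ}
    (h : ∀ m, (((t m).filter fun b => ¬ good m b).card : ℝ) ≤ (t m).card * (δ / M)) :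
    (1 - δ) * ∏ m, ((t m).card : ℝ) ≤
      ((Fintype.piFinset t).filter fun B => ∀ m, good m (B m)).card := by
  classical
  have hM : (M : ℝ) ≠ 0 := NeZero.ne _
  have hbad : ∀ m, (((Fintype.piFinset t).filter fun B => ¬ good m (B m)).card : ℝ) ≤
      δ / M * ∏ m, ((t m).card : ℝ) := fun m => by
    -- Failure at machine `m` is again a product set, with only the factor at `m` shrunk.
    have e : (Fintype.piFinset t).filter (fun B => ¬ good m (B m)) =
        Fintype.piFinset (Function.update t m ((t m).filter fun b => ¬ good m b)) := by
      ext B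
      simp only [Finset.mem_filter, Fintype.mem_piFinset]
      constructor
      · rintro ⟨h1, h2⟩ a
        rcases eq_or_ne a m with rfl | ha
        · simpa using ⟨h1 a, h2⟩
        · simpa [ha] using h1 a
      · intro h1
        have hm : B m ∈ t m ∧ ¬ good m (B m) := by simpa using h1 m
        refine ⟨fun a => ?_, hm.2⟩
        rcases eq_or_ne a m with rfl | ha
        · exact hm.1
        · simpa [ha] using h1 a
    rw [e, Fintype.card_piFinset, ← Finset.mul_prod_erase _ _ (Finset.mem_univ m),
      ← Finset.mul_prod_erase Finset.univ (fun m => ((t m).card : ℝ)) (Finset.mem_univ m)]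
    rw [Finset.prod_congr rfl fun a ha => by
      rw [Function.update_of_ne (Finset.ne_of_mem_erase ha)], Function.update_self]
    push_cast
    rw [← mul_assoc, mul_comm (δ / M)]
    exact mul_le_mul_of_nonneg_right (h m) (by positivity)
  have hcover : Fintype.piFinset t ⊆
      ((Fintype.piFinset t).filter fun B => ∀ m, good m (B m)) ∪
        Finset.univ.biUnion fun m => (Fintype.piFinset t).filter fun B => ¬ good m (B m) := by
    intro B hB
    by_cases hg : ∀ m, good m (B m)
    · exact Finset.mem_union_left _ (Finset.mem_filter.2 ⟨hB, hg⟩)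
    · obtain ⟨m, hm⟩ := not_forall.1 hg
      exact Finset.mem_union_right _ (Finset.mem_biUnion.2
        ⟨m, Finset.mem_univ m, Finset.mem_filter.2 ⟨hB, hm⟩⟩)
  have h1 : (Fintype.piFinset t).card ≤
      ((Fintype.piFinset t).filter fun B => ∀ m, good m (B m)).card +
        ∑ m, ((Fintype.piFinset t).filter fun B => ¬ good m (B m)).card :=
    (Finset.card_le_card hcover).trans ((Finset.card_union_le _ _).trans
      (Nat.add_le_add_left Finset.card_biUnion_le _))
  have h2 : ∏ m, ((t m).card : ℝ) ≤
      ((Fintype.piFinset t).filter fun B => ∀ m, good m (B m)).card +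
        ∑ m, (((Fintype.piFinset t).filter fun B => ¬ good m (B m)).card : ℝ) := by
    rw [Fintype.card_piFinset] at h1
    exact_mod_cast h1
  have h3 := Finset.sum_le_sum fun m (_ : m ∈ Finset.univ) => hbad m
  rw [Finset.sum_const, Finset.card_univ, Fintype.card_fin, nsmul_eq_mul, ← mul_assoc,
    mul_div_cancel₀ _ hM] at h3
  linarith

end Union

/-! ### Expectations restricted to a recorded event. -/

section Expectation

variable {α β γ : Type*}

lemma tsum_bind_mul (p : PMF α) (f : α → PMF β) (g : β → ℝ≥0∞) :
    ∑' b, p.bind f b * g b = ∑' a, p a * ∑' b, f a b * g b := by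
  simp_rw [PMF.bind_apply, ← ENNReal.tsum_mul_right, ← ENNReal.tsum_mul_left]
  rw [ENNReal.tsum_comm]
  simp_rw [mul_assoc]

lemma tsum_pure_mul (a : α) (g : α → ℝ≥0∞) : ∑' b, PMF.pure a b * g b = g a := by
  rw [tsum_eq_single a fun b hb => by rw [PMF.pure_apply_of_ne _ _ hb, zero_mul]]
  simp

lemma tsum_map_mul (p : PMF α) (f : α → β) (g : β → ℝ≥0∞) :
    ∑' b, p.map f b * g b = ∑' a, p a * g (f a) := by
  rw [PMF.map, tsum_bind_mul]
  simp_rw [Function.comp_apply, tsum_pure_mul]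

lemma tsum_mul_const (p : PMF α) (c : ℝ≥0∞) : ∑' a, p a * c = c := by
  rw [ENNReal.tsum_mul_right, p.tsum_coe, one_mul]

open Classical in
/-- The expectation of `g` on the recorded event. -/
noncomputable def expectEvent (p : PMF (α × Prop)) (g : α → ℝ≥0∞) : ℝ≥0∞ :=
  ∑' s, p s * (if s.2 then g s.1 else 0)

lemma expectEvent_mono (p : PMF (α × Prop)) {g h : α → ℝ≥0∞} (hgh : ∀ a, g a ≤ h a) :
    expectEvent p g ≤ expectEvent p h := by
  refine ENNReal.tsum_le_tsum fun s => ?_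
  gcongr
  split_ifs
  · exact hgh _
  · exact le_rfl

lemma expectEvent_const_mul (p : PMF (α × Prop)) (c : ℝ≥0∞) (g : α → ℝ≥0∞) :
    expectEvent p (fun a => c * g a) = c * expectEvent p g := by
  rw [expectEvent, expectEvent, ← ENNReal.tsum_mul_left]
  refine tsum_congr fun s => ?_
  split_ifs
  · ring
  · simp

/-- Only an inequality, since the constant is lost off the event. -/
lemma expectEvent_add_const_le (p : PMF (α × Prop)) (g : α → ℝ≥0∞) (c : ℝ≥0∞) :
    expectEvent p (fun a => g a + c) ≤ expectEvent p g + c := by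
  rw [← tsum_mul_const p c, expectEvent, expectEvent, ← ENNReal.tsum_add]
  refine ENNReal.tsum_le_tsum fun s => ?_
  rw [tsum_mul_const, ← mul_add]
  gcongr
  split_ifs
  · exact le_rfl
  · exact zero_le

lemma expectEvent_pure (a : α) (g : α → ℝ≥0∞) : expectEvent (PMF.pure (a, True)) g = g a := by
  rw [expectEvent, tsum_pure_mul]
  simp

/-- The tower rule: the indicator of a conjunction is a product, so the first indicator leaves the
inner expectation. -/
lemma expectEvent_bind_and (p : PMF (α × Prop)) (q : α → PMF (β × Prop)) (h : α → β → γ)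
    (g : γ → ℝ≥0∞) :
    expectEvent (p.bind fun s => (q s.1).map fun u => (h s.1 u.1, s.2 ∧ u.2)) g =
      expectEvent p fun a => expectEvent (q a) fun b => g (h a b) := by
  simp_rw [expectEvent]
  rw [tsum_bind_mul]
  refine tsum_congr fun s => ?_
  rw [tsum_map_mul]
  by_cases hs : s.2
  · rw [if_pos hs]
    refine congrArg _ (tsum_congr fun u => ?_)
    by_cases hu : u.2 <;> simp [hs, hu]
  · simp [hs]

lemma expectEvent_bind_map (p : PMF (α × Prop)) (q : PMF β) (h : α → β → γ) (g : γ → ℝ≥0∞) :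
    expectEvent (p.bind fun s => q.map fun u => (h s.1 u, s.2)) g =
      expectEvent p fun a => ∑' b, q b * g (h a b) := by
  simp_rw [expectEvent]
  rw [tsum_bind_mul]
  refine tsum_congr fun s => ?_
  rw [tsum_map_mul]
  by_cases hs : s.2 <;> simp [hs]

open Classical in
lemma expectEvent_bind_of_const (p : PMF α) (q : α → PMF β) (A : α → Prop) (h : α → β → γ)
    (g : γ → ℝ≥0∞) :
    expectEvent (p.bind fun a => (q a).map fun b => (h a b, A a)) g =
      ∑' a, p a * (if A a then ∑' b, q a b * g (h a b) else 0) := by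
  simp_rw [expectEvent]
  rw [tsum_bind_mul]
  refine tsum_congr fun s => ?_
  rw [tsum_map_mul]
  by_cases hs : A s <;> simp [hs]

lemma eventProb_eq_expectEvent (p : PMF (Vec d × Prop)) :
    eventProb p = expectEvent p fun _ => 1 := by
  rw [eventProb, PMF.toOuterMeasure_apply, expectEvent]
  refine tsum_congr fun s => ?_
  by_cases hs : s.2 <;> simp [hs]

lemma expectOn_eq_expectEvent (p : PMF (Vec d × Prop)) (g : Vec d → ℝ) :
    expectOn p g = expectEvent p fun x => ENNReal.ofReal (g x) := rfl

end Expectation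

/-! ### Probability that steps, epochs and runs are accurate. -/

section Accuracy

variable {R T : ℕ}

/-- Accuracy is decided by the subsamples alone, so the machine draws integrate out and the counting
bound applies. -/
theorem le_eventProb_innerStep [NeZero M] (P : Problem d M N)
    (hf : ∀ j, Differentiable ℝ (P.f j)) {l : Fin N → ℝ≥0} {lam : Fin M → ℝ}
    {n : Fin M → ℕ} (hnpos : ∀ m, 0 < n m) (hn : ∀ m, n m ≤ (P.S m).card) {τ δ : ℝ}
    (hτ : 0 < τ) (hδ0 : 0 < δ) (hδ1 : δ < 1) (h : SampleSizes P l lam τ δ n) (η : ℝ)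
    (y x : Vec d) :
    ENNReal.ofReal (1 - δ) ≤ eventProb (innerStep P n hn η R τ y x) := by
  classical
  have e : eventProb (innerStep P n hn η R τ y x) =
      (subsample P n hn).toOuterMeasure {B | P.Accurate τ x y B} := by
    rw [eventProb_eq_expectEvent, innerStep, expectEvent_bind_of_const, PMF.toOuterMeasure_apply]
    refine tsum_congr fun B => ?_
    by_cases hB : P.Accurate τ x y B
    · simp only [hB, if_true, mul_one, PMF.tsum_coe]
      simp [hB]
    · simp [hB]
  have hcard := one_sub_mul_prod_card_le (fun m => (P.S m).powersetCard (n m))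
    (fun m B => |(P.estWeight x y B : ℝ) - P.weight x y m| ≤ τ * P.weight x y m) (δ := δ)
    (fun m => by
      rw [Finset.card_powersetCard]
      exact card_filter_inaccurate_le P hf hτ hδ0 hδ1 (hnpos m) (hn m) (h m) x y _
        fun B hB => not_le.1 hB)
  rw [e, subsample, PMF.toOuterMeasure_uniformOfFinset_apply, Fintype.card_piFinset,
    ENNReal.le_div_iff_mul_le]
  · rw [← ENNReal.ofReal_natCast, ← ENNReal.ofReal_mul (by linarith), ← ENNReal.ofReal_natCast]
    refine ENNReal.ofReal_le_ofReal ?_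
    push_cast
    convert hcard
    rfl
  · left
    simp only [Finset.card_powersetCard, ne_eq, Nat.cast_eq_zero, Finset.prod_eq_zero_iff,
      not_exists, not_and]
    exact fun m _ => (Nat.choose_pos (hn m)).ne'
  · left
    exact ENNReal.natCast_ne_top _

variable [NeZero M] (P : Problem d M N) (n : Fin M → ℕ) (hn : ∀ m, n m ≤ (P.S m).card) (η τ : ℝ)

lemma expectEvent_trajectory_succ (y : Vec d) (t : ℕ) (g : (ℕ → Vec d) → ℝ≥0∞) :
    expectEvent (trajectory P n hn η R τ y (t + 1)) g =
      expectEvent (trajectory P n hn η R τ y t) fun s =>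
        expectEvent (innerStep P n hn η R τ y (s t)) fun x => g (Function.update s (t + 1) x) := by
  rw [trajectory]
  exact expectEvent_bind_and (trajectory P n hn η R τ y t) (fun s => innerStep P n hn η R τ y (s t))
    (fun s x => Function.update s (t + 1) x) g

lemma expectEvent_epoch [NeZero T] (y : Vec d) (g : Vec d → ℝ≥0∞) :
    expectEvent (epoch P n hn η R T τ y) g =
      expectEvent (trajectory P n hn η R τ y T) fun s =>
        ∑' t, PMF.uniformOfFintype (Fin T) t * g (s t) := by
  rw [epoch]
  refine (expectEvent_bind_map (trajectory P n hn η R τ y T) _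
    (fun (s : ℕ → Vec d) (t : ℕ) => s t) g).trans (congrArg _ (funext fun s => ?_))
  exact (tsum_bind_mul _ _ _).trans (tsum_congr fun t => congrArg _ (tsum_pure_mul _ _))

lemma expectEvent_run_succ [NeZero T] (x₀ : Vec d) (k : ℕ) (g : Vec d → ℝ≥0∞) :
    expectEvent (run P n hn η R T τ x₀ (k + 1)) g =
      expectEvent (run P n hn η R T τ x₀ k) fun x => expectEvent (epoch P n hn η R T τ x) g := by
  rw [run]
  exact expectEvent_bind_and (run P n hn η R T τ x₀ k) (fun x => epoch P n hn η R T τ x) (fun _ x => x) g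

variable {P n hn η τ}

lemma pow_le_expectEvent_trajectory {c : ℝ≥0∞} {y : Vec d}
    (h : ∀ x, c ≤ eventProb (innerStep P n hn η R τ y x)) (t : ℕ) :
    c ^ t ≤ expectEvent (trajectory P n hn η R τ y t) fun _ => 1 := by
  induction t with
  | zero => rw [trajectory, expectEvent_pure, pow_zero]
  | succ t ih =>
    rw [expectEvent_trajectory_succ, pow_succ']
    refine (mul_le_mul_right ih c).trans ?_
    rw [← expectEvent_const_mul]
    refine expectEvent_mono _ fun s => ?_
    rw [mul_one, ← eventProb_eq_expectEvent]
    exact h _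

lemma le_eventProb_epoch [NeZero T] {δ : ℝ} (hδ0 : 0 < δ) (hδ1 : δ < 1) {y : Vec d}
    (h : ∀ x, ENNReal.ofReal (1 - δ / T) ≤ eventProb (innerStep P n hn η R τ y x)) :
    ENNReal.ofReal (1 - δ) ≤ eventProb (epoch P n hn η R T τ y) := by
  have hT : (1 : ℝ) ≤ T := by exact_mod_cast NeZero.one_le
  have hδT : δ / T < 1 := by
    rw [div_lt_one (by positivity)]
    linarith
  rw [eventProb_eq_expectEvent, expectEvent_epoch]
  simp_rw [tsum_mul_const]
  refine le_trans ?_ (pow_le_expectEvent_trajectory h T)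
  rw [← ENNReal.ofReal_pow (by linarith)]
  refine ENNReal.ofReal_le_ofReal ?_
  -- Bernoulli's inequality: `(1 - δ / T) ^ T ≥ 1 - δ`.
  have h1 := one_add_mul_le_pow (a := -(δ / T)) (by linarith) T
  rw [mul_neg, mul_div_cancel₀ _ (by positivity)] at h1
  simpa [← sub_eq_add_neg] using h1

lemma pow_le_eventProb_run [NeZero T] {c : ℝ≥0∞}
    (h : ∀ y, c ≤ eventProb (epoch P n hn η R T τ y)) (x₀ : Vec d) (k : ℕ) :
    c ^ k ≤ eventProb (run P n hn η R T τ x₀ k) := by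
  rw [eventProb_eq_expectEvent]
  induction k with
  | zero => rw [run, expectEvent_pure, pow_zero]
  | succ k ih =>
    rw [expectEvent_run_succ, pow_succ']
    refine (mul_le_mul_right ih c).trans ?_
    rw [← expectEvent_const_mul]
    refine expectEvent_mono _ fun x => ?_
    rw [mul_one, ← eventProb_eq_expectEvent]
    exact h _

end Accuracy

/-! ### Second moments of sums of independent centered vectors. -/

section Moments

variable {E : Type*} [NormedAddCommGroup E] [InnerProductSpace ℝ E] {M : ℕ}

lemma sum_mul_norm_add_sq {ι : Type*} [Fintype ι] {p : ι → ℝ} (hp : ∑ m, p m = 1) {u : ι → E}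
    (hu : ∑ m, p m • u m = 0) (z : E) :
    ∑ m, p m * ‖z + u m‖ ^ 2 = ‖z‖ ^ 2 + ∑ m, p m * ‖u m‖ ^ 2 := by
  have h1 : ∑ m, p m * inner ℝ z (u m) = 0 := by
    simp_rw [← inner_smul_right]
    rw [← inner_sum, hu, inner_zero_right]
  calc ∑ m, p m * ‖z + u m‖ ^ 2
      = ∑ m, (p m * ‖z‖ ^ 2 + 2 * (p m * inner ℝ z (u m)) + p m * ‖u m‖ ^ 2) :=
        Finset.sum_congr rfl fun m _ => by rw [norm_add_sq_real]; ring
    _ = _ := by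
        rw [Finset.sum_add_distrib, Finset.sum_add_distrib, ← Finset.sum_mul, ← Finset.mul_sum, h1,
          hp]
        ring

/-- Second moment of a sum of independent centered random vectors. -/
lemma sum_prod_mul_norm_add_sum_sq {p : Fin M → ℝ} (hp : ∑ m, p m = 1) {u : Fin M → E}
    (hu : ∑ m, p m • u m = 0) (R : ℕ) (z : E) :
    ∑ i : Fin R → Fin M, (∏ r, p (i r)) * ‖z + ∑ r, u (i r)‖ ^ 2 =
      ‖z‖ ^ 2 + R * ∑ m, p m * ‖u m‖ ^ 2 := by
  induction R generalizing z with
  | zero => simp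
  | succ R ih =>
    rw [← (Fin.consEquiv fun _ : Fin (R + 1) => Fin M).sum_comp, Fintype.sum_prod_type]
    have h1 : ∀ m, ∑ i : Fin R → Fin M,
        (∏ r, p ((Fin.consEquiv fun _ : Fin (R + 1) => Fin M) (m, i) r)) *
          ‖z + ∑ r, u ((Fin.consEquiv fun _ : Fin (R + 1) => Fin M) (m, i) r)‖ ^ 2 =
        p m * ‖z + u m‖ ^ 2 + p m * (R * ∑ m, p m * ‖u m‖ ^ 2) := fun m => by
      rw [← mul_add, ← ih (z + u m), Finset.mul_sum]
      refine Finset.sum_congr rfl fun i _ => ?_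
      simp [Fin.consEquiv, Fin.prod_univ_succ, Fin.sum_univ_succ, mul_assoc, add_assoc]
    rw [Finset.sum_congr rfl fun m _ => h1 m, Finset.sum_add_distrib, ← Finset.sum_mul, hp,
      sum_mul_norm_add_sq hp hu]
    push_cast
    ring

lemma sum_prod_eq_one {p : Fin M → ℝ} (hp : ∑ m, p m = 1) (R : ℕ) :
    ∑ i : Fin R → Fin M, ∏ r, p (i r) = 1 := by
  have h := Finset.prod_univ_sum (fun _ : Fin R => (Finset.univ : Finset (Fin M))) (fun _ m => p m)
  rw [Fintype.piFinset_univ] at h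
  rw [← h]
  simp [hp]

end Moments

variable {d M N R T : ℕ}

/-! ### Unbiasedness and variance of the drawn directions. -/

section Sampling

lemma categorical_of_sum_ne_zero [NeZero M] {w : Fin M → ℝ≥0} (h : ∑ m, w m ≠ 0) (m : Fin M) :
    categorical w m = ENNReal.ofReal (w m / ∑ m', (w m' : ℝ)) := by
  rw [categorical, dif_neg h, PMF.ofFintype_apply, ENNReal.ofReal, ← NNReal.coe_sum,
    ← NNReal.coe_div, Real.toNNReal_coe]

/-- With accurate weights, the direction of a random machine is an unbiased estimate of the
gradient, with controlled variance. -/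
lemma exists_categorical_eq [NeZero M] (P : Problem d M N) (hf : ∀ j, Differentiable ℝ (P.f j))
    {τ : ℝ} (hτ0 : 0 < τ) (hτ1 : τ < 1) {x y : Vec d} {w : Fin M → ℝ≥0}
    (hw : ∀ m, |(w m : ℝ) - P.weight x y m| ≤ τ * P.weight x y m) :
    ∃ p : Fin M → ℝ, (∀ m, 0 ≤ p m) ∧ ∑ m, p m = 1 ∧
      (∀ m, categorical w m = ENNReal.ofReal (p m)) ∧
      ∑ m, p m • (direction P w x y m - ∇ P.obj x) = 0 ∧
      ∑ m, p m * ‖direction P w x y m - ∇ P.obj x‖ ^ 2 ≤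
        (1 + τ) / (1 - τ) * ((1 / (M : ℝ)) * ∑ m, (P.weight x y m : ℝ)) ^ 2 := by
  have hM : (0 : ℝ) < M := by exact_mod_cast NeZero.pos M
  set g : Fin M → Vec d := fun m => ∇ (P.localObj m) x - ∇ (P.localObj m) y with hg
  have hgw : ∀ m, ‖g m‖ = P.weight x y m := fun m => rfl
  have hgrad : ∇ P.obj x = (1 / (M : ℝ)) • ∑ m, g m + ∇ P.obj y := by
    rw [(P.hasGradientAt_obj hf x).gradient, (P.hasGradientAt_obj hf y).gradient, ← smul_add,
      hg, Finset.sum_sub_distrib, sub_add_cancel]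
  -- Since `τ < 1`, an accurate zero estimate forces the exact weight to vanish; machines that are
  -- never drawn therefore cause no bias.
  have hw0 : ∀ m, w m = 0 → g m = 0 := fun m h0 => by
    have h1 := hw m
    rw [h0, NNReal.coe_zero, zero_sub, abs_neg, ← hgw, abs_norm] at h1
    have h2 := norm_nonneg (g m)
    exact norm_le_zero_iff.1 (by nlinarith)
  have h1τ : 0 < 1 - τ := sub_pos.2 hτ1
  by_cases hsum : ∑ m, w m = 0
  · have hwz : ∀ m, w m = 0 := fun m =>
      (Finset.sum_eq_zero_iff.1 hsum) m (Finset.mem_univ m)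
    have hdir : ∀ m, direction P w x y m - ∇ P.obj x = 0 := fun m => by
      rw [direction, hgrad, Finset.sum_eq_zero fun m _ => hw0 m (hwz m)]
      simp [hwz]
    refine ⟨fun _ => 1 / M, fun _ => by positivity, ?_, fun m => ?_, ?_, ?_⟩
    · simp [hM.ne']
    · rw [categorical, dif_pos hsum, PMF.uniformOfFintype_apply, Fintype.card_fin, one_div,
        ENNReal.ofReal_inv_of_pos hM, ENNReal.ofReal_natCast]
    · simp [hdir]
    · simp only [hdir]
      simp only [norm_zero, ne_eq, OfNat.ofNat_ne_zero, not_false_eq_true, zero_pow, mul_zero,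
        Finset.sum_const_zero]
      positivity
  · set W := ∑ m, (w m : ℝ) with hWdef
    have hW : 0 < W := by
      have h0 : 0 < ∑ m, w m := pos_iff_ne_zero.2 hsum
      rw [hWdef, ← NNReal.coe_sum]
      exact_mod_cast h0
    set p : Fin M → ℝ := fun m => w m / W with hp
    have hp1 : ∑ m, p m = 1 := by rw [hp, ← Finset.sum_div, ← hWdef, div_self hW.ne']
    set h : Fin M → Vec d := fun m => (1 / ((M : ℝ) * p m)) • g m with hh
    have hph : ∀ m, p m • h m = (1 / (M : ℝ)) • g m := fun m => by
      by_cases h0 : w m = 0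
      · simp [hh, hw0 m h0]
      · have : p m ≠ 0 := div_ne_zero (by exact_mod_cast h0) hW.ne'
        rw [hh, smul_smul]
        congr 1
        field_simp
    have hdir : ∀ m, direction P w x y m - ∇ P.obj x = h m - (1 / (M : ℝ)) • ∑ m, g m := fun m => by
      rw [direction, hgrad, add_sub_add_right_eq_sub]
    have hcent : ∑ m, p m • (h m - (1 / (M : ℝ)) • ∑ m, g m) = 0 := by
      simp_rw [smul_sub, hph]
      rw [Finset.sum_sub_distrib, ← Finset.smul_sum, ← Finset.sum_smul, hp1, one_smul, sub_self]
    refine ⟨p, fun m => by positivity, hp1, categorical_of_sum_ne_zero hsum, ?_, ?_⟩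
    · simp_rw [hdir]
      exact hcent
    · simp_rw [hdir]
      have hvar := sum_mul_norm_add_sq hp1 hcent ((1 / (M : ℝ)) • ∑ m, g m)
      simp_rw [add_sub_cancel] at hvar
      -- Importance sampling: the term equals `W ‖g m‖² / (M² w m)`. The lower accuracy bound
      -- controls `‖g m‖ / w m`, and the upper one, below, controls `W`.
      have hle : ∀ m, p m * ‖h m‖ ^ 2 ≤ W / (1 - τ) / (M : ℝ) ^ 2 * ‖g m‖ := fun m => by
        by_cases h0 : w m = 0
        · simp only [hh, hw0 m h0, smul_zero, norm_zero]
          simp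
        · have hwm : (0 : ℝ) < w m := by exact_mod_cast pos_iff_ne_zero.2 h0
          have h1 : (1 - τ) * ‖g m‖ ≤ w m := by
            have := (abs_le.1 (hw m)).1
            rw [← hgw] at this
            linarith
          rw [hh, norm_smul, Real.norm_of_nonneg (by positivity), hp]
          have e : (w m : ℝ) / W * (1 / ((M : ℝ) * (w m / W)) * ‖g m‖) ^ 2 =
              W / (M : ℝ) ^ 2 * ‖g m‖ * (‖g m‖ / w m) := by
            field_simp
          rw [e]
          have h2 : ‖g m‖ / w m ≤ 1 / (1 - τ) := by
            rw [div_le_div_iff₀ hwm h1τ]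
            linarith
          calc W / (M : ℝ) ^ 2 * ‖g m‖ * (‖g m‖ / w m)
              ≤ W / (M : ℝ) ^ 2 * ‖g m‖ * (1 / (1 - τ)) := by gcongr
            _ = _ := by ring
      have hWle : W ≤ (1 + τ) * ∑ m, (P.weight x y m : ℝ) := by
        rw [hWdef, Finset.mul_sum]
        refine Finset.sum_le_sum fun m _ => ?_
        have := (abs_le.1 (hw m)).2
        linarith
      have hsumle := Finset.sum_le_sum fun m (_ : m ∈ Finset.univ) => hle m
      rw [← Finset.mul_sum] at hsumle
      simp_rw [hgw] at hsumle
      calc ∑ m, p m * ‖h m - (1 / (M : ℝ)) • ∑ m, g m‖ ^ 2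
          ≤ ∑ m, p m * ‖h m‖ ^ 2 := by
            rw [hvar]
            exact le_add_of_nonneg_left (by positivity)
        _ ≤ W / (1 - τ) / (M : ℝ) ^ 2 * ∑ m, (P.weight x y m : ℝ) := hsumle
        _ ≤ ((1 + τ) * ∑ m, (P.weight x y m : ℝ)) / (1 - τ) / (M : ℝ) ^ 2 *
            ∑ m, (P.weight x y m : ℝ) := by gcongr
        _ = _ := by
            field_simp

lemma update_eq (P : Problem d M N) (η : ℝ) (w : Fin M → ℝ≥0) (x y : Vec d) (i : Fin R → Fin M) :
    update P η w x y i = x - ∑ r, (η / R) • direction P w x y (i r) := by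
  rw [update, ← Finset.smul_sum]
  have h : ∑ m, ((histogram i m : ℝ) / (R : ℝ)) • direction P w x y m =
      (1 / (R : ℝ)) • ∑ r, direction P w x y (i r) := by
    rw [← Finset.sum_fiberwise Finset.univ i fun r => direction P w x y (i r), Finset.smul_sum]
    refine Finset.sum_congr rfl fun m _ => ?_
    rw [Finset.sum_congr rfl fun r hr => by rw [(Finset.mem_filter.1 hr).2], Finset.sum_const,
      ← Nat.cast_smul_eq_nsmul ℝ, smul_smul, histogram]
    congr 1
    ring
  rw [h, smul_smul, mul_one_div]

end Sampling

/-! ### Descent in one step, over an epoch, and over a run. -/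

section Descent

variable [NeZero M] (P : Problem d M N) (hf : ∀ j, Differentiable ℝ (P.f j))
  (hconv : ∀ m, ConvexOn ℝ Set.univ (P.localObj m))
  {L : Fin M → ℝ≥0} (hL : ∀ m, LipschitzWith (L m) (∇ (P.localObj m)))
  {xstar : Vec d} (hmin : ∀ x, P.obj xstar ≤ P.obj x)

include hf hconv hL hmin

/-- Each squared norm is at most `2 L_m` times a Bregman divergence at `xstar`. Cauchy-Schwarz
separates the two factors, and the divergences average to the gap of `F` because the linear terms
cancel at the minimizer. -/
lemma avg_norm_gradient_sub_sq_le (x : Vec d) :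
    ((1 / (M : ℝ)) * ∑ m, ‖∇ (P.localObj m) x - ∇ (P.localObj m) xstar‖) ^ 2 ≤
      2 * avgLip L * (P.obj x - P.obj xstar) := by
  have hM : (0 : ℝ) < M := by exact_mod_cast NeZero.pos M
  set D : Fin M → ℝ := fun m => P.localObj m x - P.localObj m xstar -
    inner ℝ (∇ (P.localObj m) xstar) (x - xstar) with hD
  have hD0 : ∀ m, 0 ≤ D m := fun m => by
    have := inner_gradient_le_sub_of_convexOn (P.differentiable_localObj hf m) (hconv m) xstar x
    exact sub_nonneg.2 this
  have hsum : (1 / (M : ℝ)) * ∑ m, D m = P.obj x - P.obj xstar := by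
    have h0 := gradient_eq_zero_of_forall_le hmin
    rw [(P.hasGradientAt_obj hf xstar).gradient] at h0
    have h1 : (1 / (M : ℝ)) * ∑ m, inner ℝ (∇ (P.localObj m) xstar) (x - xstar) = 0 := by
      rw [← sum_inner, ← real_inner_smul_left, h0, inner_zero_left]
    rw [hD, Finset.sum_sub_distrib, Finset.sum_sub_distrib, mul_sub, mul_sub, h1, sub_zero]
    rfl
  have hcs : (∑ m, ‖∇ (P.localObj m) x - ∇ (P.localObj m) xstar‖) ^ 2 ≤
      (∑ m, 2 * (L m : ℝ)) * ∑ m, D m :=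
    Finset.sum_sq_le_sum_mul_sum_of_sq_le_mul _ (fun m _ => by positivity) (fun m _ => hD0 m)
      fun m _ => norm_gradient_sub_sq_le (P.differentiable_localObj hf m) (hconv m) (hL m) x xstar
  rw [← hsum, avgLip, mul_pow]
  rw [← Finset.mul_sum] at hcs
  calc (1 / (M : ℝ)) ^ 2 * (∑ m, ‖∇ (P.localObj m) x - ∇ (P.localObj m) xstar‖) ^ 2
      ≤ (1 / (M : ℝ)) ^ 2 * ((2 * ∑ m, (L m : ℝ)) * ∑ m, D m) := by gcongr
    _ = _ := by ring

lemma norm_gradient_obj_sq_le (x : Vec d) :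
    ‖∇ P.obj x‖ ^ 2 ≤ 2 * avgLip L * (P.obj x - P.obj xstar) := by
  refine le_trans ?_ (avg_norm_gradient_sub_sq_le P hf hconv hL hmin x)
  have h0 := gradient_eq_zero_of_forall_le hmin
  have e : ∇ P.obj x =
      (1 / (M : ℝ)) • ∑ m, (∇ (P.localObj m) x - ∇ (P.localObj m) xstar) := by
    rw [Finset.sum_sub_distrib, smul_sub, ← (P.hasGradientAt_obj hf xstar).gradient, h0, sub_zero,
      (P.hasGradientAt_obj hf x).gradient]
  rw [e, norm_smul, Real.norm_of_nonneg (by positivity)]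
  gcongr
  exact norm_sum_le _ _

lemma avg_weight_sq_le (x y : Vec d) :
    ((1 / (M : ℝ)) * ∑ m, (P.weight x y m : ℝ)) ^ 2 ≤
      4 * avgLip L * ((P.obj x - P.obj xstar) + (P.obj y - P.obj xstar)) := by
  have hx := avg_norm_gradient_sub_sq_le P hf hconv hL hmin x
  have hy := avg_norm_gradient_sub_sq_le P hf hconv hL hmin y
  set a := (1 / (M : ℝ)) * ∑ m, ‖∇ (P.localObj m) x - ∇ (P.localObj m) xstar‖
  set b := (1 / (M : ℝ)) * ∑ m, ‖∇ (P.localObj m) y - ∇ (P.localObj m) xstar‖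
  have h : (1 / (M : ℝ)) * ∑ m, (P.weight x y m : ℝ) ≤ a + b := by
    rw [← mul_add, ← Finset.sum_add_distrib]
    gcongr with m _
    rw [norm_sub_rev (∇ (P.localObj m) y)]
    exact norm_sub_le_norm_sub_add_norm_sub _ _ _
  have h2 := pow_le_pow_left₀ (by positivity) h 2
  nlinarith [sq_nonneg (a - b)]

/-- Bias-variance split: `z` is the exact gradient step and the draws add independent centered
noise. The constant `C` lets later estimates carry accumulated gaps inside `ENNReal.ofReal`, so that
the negative term need not be moved across an inequality in `ℝ≥0∞`. -/
lemma tsum_iidDraws_mul_le [NeZero R] {τ c : ℝ} (hτ0 : 0 < τ) (hτ1 : τ < 1)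
    (hc : 2 * ((1 + τ) / (1 - τ)) ≤ c) {η : ℝ} (hη : 0 < η) {x y : Vec d} {w : Fin M → ℝ≥0}
    (hw : ∀ m, |(w m : ℝ) - P.weight x y m| ≤ τ * P.weight x y m) {C : ℝ} (hC : 0 ≤ C) :
    ∑' i, iidDraws (categorical w) R i *
        ENNReal.ofReal (‖update P η w x y i - xstar‖ ^ 2 + C) ≤
      ENNReal.ofReal (‖x - xstar‖ ^ 2
        - 2 * η * (1 - η * avgLip L * (c / R + 1)) * (P.obj x - P.obj xstar)
        + 2 * η ^ 2 * avgLip L * (c / R) * (P.obj y - P.obj xstar) + C) := by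
  have hR : (0 : ℝ) < R := by exact_mod_cast NeZero.pos R
  obtain ⟨p, hp0, hp1, hpw, hcent, hvar⟩ := exists_categorical_eq P hf hτ0 hτ1 hw
  have hprod : ∀ i : Fin R → Fin M, 0 ≤ ∏ r, p (i r) := fun i =>
    Finset.prod_nonneg fun r _ => hp0 _
  set z := x - xstar - η • ∇ P.obj x with hz
  set u : Fin M → Vec d := fun m => -(η / R) • (direction P w x y m - ∇ P.obj x) with hu
  have hupd : ∀ i : Fin R → Fin M, update P η w x y i - xstar = z + ∑ r, u (i r) := fun i => by
    have hs : ∑ r, u (i r) = η • ∇ P.obj x - ∑ r, (η / R) • direction P w x y (i r) := by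
      simp only [hu, neg_smul, smul_sub, Finset.sum_neg_distrib, Finset.sum_sub_distrib,
        Finset.sum_const, Finset.card_univ, Fintype.card_fin]
      rw [← Nat.cast_smul_eq_nsmul ℝ, smul_smul, mul_div_cancel₀ _ hR.ne']
      abel
    rw [update_eq, hs, hz]
    abel
  have hucent : ∑ m, p m • u m = 0 := by
    simp only [hu]
    simp_rw [smul_comm (p _)]
    rw [← Finset.smul_sum, hcent, smul_zero]
  have hvaru : ∑ m, p m * ‖u m‖ ^ 2 =
      (η / R) ^ 2 * ∑ m, p m * ‖direction P w x y m - ∇ P.obj x‖ ^ 2 := by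
    rw [Finset.mul_sum]
    refine Finset.sum_congr rfl fun m _ => ?_
    rw [hu, norm_smul, norm_neg, Real.norm_of_nonneg (by positivity)]
    ring
  have hmom := sum_prod_mul_norm_add_sum_sq hp1 hucent R z
  rw [tsum_fintype]
  have hterm : ∀ i : Fin R → Fin M, iidDraws (categorical w) R i *
      ENNReal.ofReal (‖update P η w x y i - xstar‖ ^ 2 + C) =
      ENNReal.ofReal ((∏ r, p (i r)) * ‖z + ∑ r, u (i r)‖ ^ 2 + (∏ r, p (i r)) * C) := fun i => by
    rw [iidDraws, PMF.ofFintype_apply, ← mul_add, ENNReal.ofReal_mul (hprod i),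
      ENNReal.ofReal_prod_of_nonneg fun r _ => hp0 _, hupd]
    simp_rw [hpw]
  rw [Finset.sum_congr rfl fun i _ => hterm i, ← ENNReal.ofReal_sum_of_nonneg fun i _ =>
    add_nonneg (mul_nonneg (hprod i) (sq_nonneg _)) (mul_nonneg (hprod i) hC)]
  refine ENNReal.ofReal_le_ofReal ?_
  rw [Finset.sum_add_distrib, ← Finset.sum_mul, sum_prod_eq_one hp1, one_mul, hmom, hvaru]
  have hgrad := norm_gradient_obj_sq_le P hf hconv hL hmin x
  have hwt := avg_weight_sq_le P hf hconv hL hmin x y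
  have hΔx : 0 ≤ P.obj x - P.obj xstar := sub_nonneg.2 (hmin x)
  have hΔy : 0 ≤ P.obj y - P.obj xstar := sub_nonneg.2 (hmin y)
  have hobj : ConvexOn ℝ Set.univ P.obj := by
    have h1 : ConvexOn ℝ Set.univ (∑ m, P.localObj m) := by
      refine Finset.sum_induction _ (ConvexOn ℝ Set.univ) (fun _ _ h1 h2 => h1.add h2)
        (convexOn_const 0 convex_univ) fun m _ => hconv m
    have h2 := h1.smul (c := 1 / (M : ℝ)) (by positivity)
    refine h2.congr fun x _ => ?_
    simp [Problem.obj]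
  have hfirst := inner_gradient_le_sub_of_convexOn (P.differentiable_obj hf) hobj x xstar
  have e1 : inner ℝ (∇ P.obj x) (xstar - x) = -inner ℝ (x - xstar) (∇ P.obj x) := by
    rw [real_inner_comm, ← inner_neg_left, neg_sub]
  rw [e1] at hfirst
  have hLbar : 0 ≤ avgLip L := by unfold avgLip; positivity
  have e2 : ‖z‖ ^ 2 = ‖x - xstar‖ ^ 2 - 2 * (η * inner ℝ (x - xstar) (∇ P.obj x)) +
      η ^ 2 * ‖∇ P.obj x‖ ^ 2 := by
    rw [hz, norm_sub_sq_real, inner_smul_right, norm_smul, Real.norm_of_nonneg hη.le, mul_pow]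
  set Δx := P.obj x - P.obj xstar
  set Δy := P.obj y - P.obj xstar
  have hq : 0 ≤ (1 + τ) / (1 - τ) := div_nonneg (by linarith) (by linarith)
  have h1 : ∑ m, p m * ‖direction P w x y m - ∇ P.obj x‖ ^ 2 ≤ 2 * c * avgLip L * (Δx + Δy) := by
    calc _ ≤ (1 + τ) / (1 - τ) * ((1 / (M : ℝ)) * ∑ m, (P.weight x y m : ℝ)) ^ 2 := hvar
      _ ≤ (1 + τ) / (1 - τ) * (4 * avgLip L * (Δx + Δy)) := by gcongr
      _ = 2 * ((1 + τ) / (1 - τ)) * (2 * avgLip L * (Δx + Δy)) := by ring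
      _ ≤ c * (2 * avgLip L * (Δx + Δy)) := by gcongr
      _ = _ := by ring
  have h2 : R * ((η / R) ^ 2 * ∑ m, p m * ‖direction P w x y m - ∇ P.obj x‖ ^ 2) ≤
      2 * η ^ 2 * avgLip L * (c / R) * (Δx + Δy) := by
    calc _ ≤ R * ((η / R) ^ 2 * (2 * c * avgLip L * (Δx + Δy))) := by gcongr
      _ = _ := by field_simp
  have h3 : η ^ 2 * ‖∇ P.obj x‖ ^ 2 ≤ η ^ 2 * (2 * avgLip L * Δx) := by gcongr
  have h4 : η * Δx ≤ η * inner ℝ (x - xstar) (∇ P.obj x) := by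
    gcongr
    linarith
  rw [e2]
  linarith

variable (n : Fin M → ℕ) (hn : ∀ m, n m ≤ (P.S m).card)

lemma expectEvent_innerStep_le [NeZero R] {τ c : ℝ} (hτ0 : 0 < τ) (hτ1 : τ < 1)
    (hc : 2 * ((1 + τ) / (1 - τ)) ≤ c) {η : ℝ} (hη : 0 < η) (x y : Vec d) {C : ℝ} (hC : 0 ≤ C) :
    expectEvent (innerStep P n hn η R τ y x)
        (fun x' => ENNReal.ofReal (‖x' - xstar‖ ^ 2 + C)) ≤
      ENNReal.ofReal (‖x - xstar‖ ^ 2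
        - 2 * η * (1 - η * avgLip L * (c / R + 1)) * (P.obj x - P.obj xstar)
        + 2 * η ^ 2 * avgLip L * (c / R) * (P.obj y - P.obj xstar) + C) := by
  rw [innerStep, expectEvent_bind_of_const]
  refine le_trans (ENNReal.tsum_le_tsum fun B => ?_) (tsum_mul_const (subsample P n hn) _).le
  gcongr
  split_ifs with hB
  · exact tsum_iidDraws_mul_le P hf hconv hL hmin hτ0 hτ1 hc hη hB hC
  · exact zero_le

/-- The potential is the squared distance plus the weighted gaps accumulated so far: each step
trades the decrease in distance for one more gap and adds only the constant `K`, which depends on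
`y`. -/
lemma expectEvent_trajectory_le [NeZero R] {τ c : ℝ} (hτ0 : 0 < τ) (hτ1 : τ < 1)
    (hc : 2 * ((1 + τ) / (1 - τ)) ≤ c) {η : ℝ} (hη : 0 < η)
    (hη_small : η * avgLip L * (c / R + 1) < 1) (y : Vec d) (t : ℕ) :
    expectEvent (trajectory P n hn η R τ y t)
        (fun s => ENNReal.ofReal (‖s t - xstar‖ ^ 2 +
          2 * η * (1 - η * avgLip L * (c / R + 1)) *
            ∑ i ∈ Finset.range t, (P.obj (s i) - P.obj xstar))) ≤
      ENNReal.ofReal (‖y - xstar‖ ^ 2 +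
        t * (2 * η ^ 2 * avgLip L * (c / R) * (P.obj y - P.obj xstar))) := by
  have hκ : 0 < 1 - η * avgLip L * (c / R + 1) := sub_pos.2 hη_small
  set κ := 1 - η * avgLip L * (c / R + 1) with hκdef
  have hLbar : 0 ≤ avgLip L := by unfold avgLip; positivity
  have hc0 : 0 ≤ c := le_trans (mul_nonneg zero_le_two
    (div_nonneg (by linarith) (by linarith))) hc
  have hΔ : ∀ x, 0 ≤ P.obj x - P.obj xstar := fun x => sub_nonneg.2 (hmin x)
  set K := 2 * η ^ 2 * avgLip L * (c / R) * (P.obj y - P.obj xstar) with hK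
  have hK0 : 0 ≤ K := mul_nonneg (by positivity) (hΔ y)
  induction t with
  | zero => simp [trajectory, expectEvent_pure]
  | succ t ih =>
    rw [expectEvent_trajectory_succ]
    have hstep : ∀ s : ℕ → Vec d, expectEvent (innerStep P n hn η R τ y (s t)) (fun x =>
        ENNReal.ofReal (‖Function.update s (t + 1) x (t + 1) - xstar‖ ^ 2 + 2 * η * κ *
          ∑ i ∈ Finset.range (t + 1),
            (P.obj (Function.update s (t + 1) x i) - P.obj xstar))) ≤
        ENNReal.ofReal (‖s t - xstar‖ ^ 2 +
          2 * η * κ * ∑ i ∈ Finset.range t, (P.obj (s i) - P.obj xstar)) +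
        ENNReal.ofReal K := fun s => by
      have hsum : ∀ x, ∑ i ∈ Finset.range (t + 1),
          (P.obj (Function.update s (t + 1) x i) - P.obj xstar) =
          ∑ i ∈ Finset.range t, (P.obj (s i) - P.obj xstar) + (P.obj (s t) - P.obj xstar) :=
        fun x => by
          rw [← Finset.sum_range_succ]
          refine Finset.sum_congr rfl fun i hi => ?_
          rw [Function.update_of_ne (Finset.mem_range.1 hi).ne]
      simp_rw [hsum, Function.update_self]
      have h0 : 0 ≤ ∑ i ∈ Finset.range t, (P.obj (s i) - P.obj xstar) :=
        Finset.sum_nonneg fun i _ => hΔ _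
      have h1 := hΔ (s t)
      generalize ∑ i ∈ Finset.range t, (P.obj (s i) - P.obj xstar) = σ at h0 ⊢
      have hC : 0 ≤ 2 * η * κ * (σ + (P.obj (s t) - P.obj xstar)) := by positivity
      have hin := expectEvent_innerStep_le (R := R) P hf hconv hL hmin n hn hτ0 hτ1 hc hη (s t) y
        hC
      rw [← hκdef, ← hK] at hin
      refine hin.trans ?_
      rw [← ENNReal.ofReal_add (by positivity) hK0]
      refine ENNReal.ofReal_le_ofReal (le_of_eq ?_)
      ring
    refine (expectEvent_mono _ hstep).trans ((expectEvent_add_const_le _ _ _).trans ?_)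
    refine (add_le_add_left ih _).trans ?_
    rw [← ENNReal.ofReal_add (by positivity) hK0]
    refine ENNReal.ofReal_le_ofReal (le_of_eq ?_)
    push_cast
    ring

/-- The uniform choice of the returned index turns the accumulated gaps into their mean. The final
distance is dropped, and the initial one is at most `2 / lamF` times the gap at `y`. -/
lemma expectEvent_epoch_le [NeZero R] [NeZero T] {lamF : ℝ} (hlamF : 0 < lamF)
    (hF : StrongConvexOn Set.univ lamF P.obj) {τ c : ℝ} (hτ0 : 0 < τ) (hτ1 : τ < 1)
    (hc : 2 * ((1 + τ) / (1 - τ)) ≤ c) {η : ℝ} (hη : 0 < η)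
    (hη_small : η * avgLip L * (c / R + 1) < 1) (y : Vec d) :
    expectEvent (epoch P n hn η R T τ y) (fun x => ENNReal.ofReal (P.obj x - P.obj xstar)) ≤
      ENNReal.ofReal (rate lamF η (avgLip L) c R T) *
        ENNReal.ofReal (P.obj y - P.obj xstar) := by
  have hT : (0 : ℝ) < T := by exact_mod_cast NeZero.pos T
  have hR : (0 : ℝ) < R := by exact_mod_cast NeZero.pos R
  have hκ : 0 < 1 - η * avgLip L * (c / R + 1) := sub_pos.2 hη_small
  have htraj := expectEvent_trajectory_le P hf hconv hL hmin n hn hτ0 hτ1 hc hη hη_small y T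
  have hΔ : ∀ x, 0 ≤ P.obj x - P.obj xstar := fun x => sub_nonneg.2 (hmin x)
  rw [expectEvent_epoch, ← ENNReal.ofReal_mul' (hΔ y), rate]
  set κ := 1 - η * avgLip L * (c / R + 1)
  have hs : ∀ s : ℕ → Vec d, ∑' t : Fin T, PMF.uniformOfFintype (Fin T) t *
      ENNReal.ofReal (P.obj (s t) - P.obj xstar) ≤
      ENNReal.ofReal (1 / (2 * η * κ * T)) * ENNReal.ofReal (‖s T - xstar‖ ^ 2 +
        2 * η * κ * ∑ i ∈ Finset.range T, (P.obj (s i) - P.obj xstar)) := fun s => by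
    rw [tsum_fintype, ← ENNReal.ofReal_mul (by positivity)]
    simp_rw [PMF.uniformOfFintype_apply, Fintype.card_fin]
    rw [← Finset.mul_sum, ← ENNReal.ofReal_sum_of_nonneg fun t _ => hΔ _,
      ← ENNReal.ofReal_natCast, ← ENNReal.ofReal_inv_of_pos hT,
      ← ENNReal.ofReal_mul (by positivity),
      Fin.sum_univ_eq_sum_range (fun t => P.obj (s t) - P.obj xstar)]
    refine ENNReal.ofReal_le_ofReal ?_
    calc (T : ℝ)⁻¹ * ∑ i ∈ Finset.range T, (P.obj (s i) - P.obj xstar)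
        = 1 / (2 * η * κ * T) *
          (2 * η * κ * ∑ i ∈ Finset.range T, (P.obj (s i) - P.obj xstar)) := by
          field_simp
      _ ≤ _ := by
          gcongr
          exact le_add_of_nonneg_left (sq_nonneg _)
  refine (expectEvent_mono _ hs).trans ?_
  rw [expectEvent_const_mul]
  refine (mul_le_mul_right htraj _).trans ?_
  rw [← ENNReal.ofReal_mul (by positivity)]
  refine ENNReal.ofReal_le_ofReal ?_
  have hgrow := norm_sub_sq_le_of_strongConvexOn (P.differentiable_obj hf) hlamF hF hmin y
  set Δy := P.obj y - P.obj xstar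
  calc 1 / (2 * η * κ * T) * (‖y - xstar‖ ^ 2 + T * (2 * η ^ 2 * avgLip L * (c / R) * Δy))
      ≤ 1 / (2 * η * κ * T) * (2 / lamF * Δy + T * (2 * η ^ 2 * avgLip L * (c / R) * Δy)) := by
        gcongr
    _ = _ := by
        field_simp

theorem expectOn_run_succ_le [NeZero R] [NeZero T] {lamF : ℝ} (hlamF : 0 < lamF)
    (hF : StrongConvexOn Set.univ lamF P.obj) {τ c : ℝ} (hτ0 : 0 < τ) (hτ1 : τ < 1)
    (hc : 2 * ((1 + τ) / (1 - τ)) ≤ c) {η : ℝ} (hη : 0 < η)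
    (hη_small : η * avgLip L * (c / R + 1) < 1) (x₀ : Vec d) (k : ℕ) :
    expectOn (run P n hn η R T τ x₀ (k + 1)) (fun x => P.obj x - P.obj xstar) ≤
      ENNReal.ofReal (rate lamF η (avgLip L) c R T) *
        expectOn (run P n hn η R T τ x₀ k) (fun x => P.obj x - P.obj xstar) := by
  rw [expectOn_eq_expectEvent, expectOn_eq_expectEvent, expectEvent_run_succ,
    ← expectEvent_const_mul]
  exact expectEvent_mono _ fun x =>
    expectEvent_epoch_le P hf hconv hL hmin n hn hlamF hF hτ0 hτ1 hc hη hη_small x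

end Descent

/-! ### Positivity of the rate and the condition for contraction. -/

section Rate

lemma rate_pos {lamF η Lbar c : ℝ} [NeZero R] [NeZero T] (hlamF : 0 < lamF) (hη : 0 < η)
    (hLbar : 0 ≤ Lbar) (hc : 0 ≤ c) (h : η * Lbar * (c / R + 1) < 1) :
    0 < rate lamF η Lbar c R T := by
  have hT : (0 : ℝ) < T := by exact_mod_cast NeZero.pos T
  have hκ : 0 < 1 - η * Lbar * (c / R + 1) := sub_pos.2 h
  unfold rate
  positivity

lemma rate_lt_one {lamF η Lbar c : ℝ} [NeZero R] [NeZero T] (hlamF : 0 < lamF) (hη : 0 < η)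
    (h : η * Lbar * (c / R + 1) < 1)
    (h1 : 1 < lamF * T * η * (1 - η * Lbar * (2 * c / R + 1))) :
    rate lamF η Lbar c R T < 1 := by
  have hT : (0 : ℝ) < T := by exact_mod_cast NeZero.pos T
  have hR : (0 : ℝ) < R := by exact_mod_cast NeZero.pos R
  have hκ : 0 < 1 - η * Lbar * (c / R + 1) := sub_pos.2 h
  have hs : 0 < lamF * T * η := by positivity
  have h2 : 1 / (lamF * T * η) < 1 - η * Lbar * (2 * c / R + 1) := by
    rw [div_lt_iff₀ hs, mul_comm]
    exact h1
  have e : rate lamF η Lbar c R T =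
      (1 / (lamF * T * η) + c * η * Lbar / R) / (1 - η * Lbar * (c / R + 1)) := by
    rw [rate, add_div, div_div, div_div]
  rw [e, div_lt_one hκ]
  -- Moving the second summand of the rate to the other side doubles `c`.
  have e2 : 1 - η * Lbar * (c / R + 1) - c * η * Lbar / R = 1 - η * Lbar * (2 * c / R + 1) := by
    ring
  linarith

end Rate

end ASDSVRG

/-! ### Assembly of the main theorem. -/

open ASDSVRG in
theorem mainTheorem1 {d M N R T : ℕ} [NeZero M] [NeZero R] [NeZero T]
    (P : Problem d M N)
    (hf : ∀ j, Differentiable ℝ (P.f j))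
    (hconv : ∀ m, ConvexOn ℝ Set.univ (P.localObj m))
    (L : Fin M → ℝ≥0) (hL : ∀ m, LipschitzWith (L m) (∇ (P.localObj m)))
    (lamF : ℝ) (hlamF : 0 < lamF) (hF : StrongConvexOn Set.univ lamF P.obj)
    (l : Fin N → ℝ≥0) (lam : Fin M → ℝ)
    (xstar : Vec d) (hmin : ∀ x, P.obj xstar ≤ P.obj x)
    (n : Fin M → ℕ) (hnpos : ∀ m, 0 < n m) (hn : ∀ m, n m ≤ (P.S m).card)
    (τ c : ℝ) (hτ : (0 < τ ∧ τ ≤ 1 / 5 ∧ c = 2 + 5 * τ) ∨ (τ = 1 / 3 ∧ c = 8))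
    (η : ℝ) (hη : 0 < η) (hη_small : η * avgLip L * (c / R + 1) < 1) :
    (∀ δ : ℝ, 0 < δ → δ < 1 → SampleSizes P l lam τ δ n →
      ∀ y x : Vec d, ENNReal.ofReal (1 - δ) ≤ eventProb (innerStep P n hn η R τ y x)) ∧
    (∀ δ : ℝ, 0 < δ → δ < 1 → SampleSizes P l lam τ (δ / T) n →
      (∀ y : Vec d, ENNReal.ofReal (1 - δ) ≤ eventProb (epoch P n hn η R T τ y)) ∧
      (∀ (x₀ : Vec d) (k : ℕ),
        ENNReal.ofReal ((1 - δ) ^ k) ≤ eventProb (run P n hn η R T τ x₀ k))) ∧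
    (∀ (x₀ : Vec d) (k : ℕ),
      expectOn (run P n hn η R T τ x₀ (k + 1)) (fun x => P.obj x - P.obj xstar) ≤
        ENNReal.ofReal (rate lamF η (avgLip L) c R T) *
          expectOn (run P n hn η R T τ x₀ k) (fun x => P.obj x - P.obj xstar)) ∧
    (∀ (x₀ : Vec d) (k : ℕ),
      expectOn (run P n hn η R T τ x₀ k) (fun x => P.obj x - P.obj xstar) ≤
        ENNReal.ofReal (rate lamF η (avgLip L) c R T ^ k * (P.obj x₀ - P.obj xstar)) ∧
      expectOn (run P n hn η R T τ x₀ k) (fun x => ‖x - xstar‖ ^ 2) ≤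
        ENNReal.ofReal (2 / lamF * rate lamF η (avgLip L) c R T ^ k *
          (P.obj x₀ - P.obj xstar))) ∧
    0 < rate lamF η (avgLip L) c R T ∧
    (1 < lamF * T * η * (1 - η * avgLip L * (2 * c / R + 1)) →
      rate lamF η (avgLip L) c R T < 1) := by
  obtain ⟨hτ0, hτ1, hc⟩ : 0 < τ ∧ τ < 1 ∧ 2 * ((1 + τ) / (1 - τ)) ≤ c := by
    -- The two parameter regimes enter the descent only through `2 (1 + τ) / (1 - τ) ≤ c`. For `c =
    -- 2 + 5 τ` this is equivalent to `5 τ² ≤ τ`, hence the bound `1 / 5`; for `τ = 1 / 3` the left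
    -- side is `4`.
    rcases hτ with ⟨h1, h2, rfl⟩ | ⟨rfl, rfl⟩
    · refine ⟨h1, by linarith, ?_⟩
      rw [← mul_div_assoc, div_le_iff₀ (by linarith)]
      nlinarith
    · norm_num
  have hc0 : 0 ≤ c := le_trans (mul_nonneg zero_le_two
    (div_nonneg (by linarith) (by linarith))) hc
  have hLbar : 0 ≤ avgLip L := by unfold avgLip; positivity
  have hrate : 0 < rate lamF η (avgLip L) c R T := rate_pos hlamF hη hLbar hc0 hη_small
  have hcontract := expectOn_run_succ_le (T := T) P hf hconv hL hmin n hn hlamF hF hτ0 hτ1 hc hη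
    hη_small
  have hlin : ∀ (x₀ : Vec d) (k : ℕ),
      expectOn (run P n hn η R T τ x₀ k) (fun x => P.obj x - P.obj xstar) ≤
        ENNReal.ofReal (rate lamF η (avgLip L) c R T ^ k * (P.obj x₀ - P.obj xstar)) := by
    intro x₀ k
    induction k with
    | zero => rw [expectOn_eq_expectEvent, run, expectEvent_pure, pow_zero, one_mul]
    | succ k ih =>
      refine (hcontract x₀ k).trans ((mul_le_mul_right ih _).trans ?_)
      rw [← ENNReal.ofReal_mul hrate.le, pow_succ', mul_assoc]
  refine ⟨fun δ hδ0 hδ1 h y x => le_eventProb_innerStep P hf hnpos hn hτ0 hδ0 hδ1 h η y x,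
    fun δ hδ0 hδ1 h => ?_, hcontract, fun x₀ k => ⟨hlin x₀ k, ?_⟩, hrate,
    rate_lt_one hlamF hη hη_small⟩
  · have hT : (1 : ℝ) ≤ T := by exact_mod_cast NeZero.one_le
    have hepoch : ∀ y : Vec d, ENNReal.ofReal (1 - δ) ≤ eventProb (epoch P n hn η R T τ y) :=
      fun y => le_eventProb_epoch hδ0 hδ1 fun x =>
        le_eventProb_innerStep P hf hnpos hn hτ0 (by positivity)
          ((div_le_self hδ0.le hT).trans_lt hδ1) h η y x
    refine ⟨hepoch, fun x₀ k => ?_⟩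
    rw [ENNReal.ofReal_pow (by linarith)]
    exact pow_le_eventProb_run hepoch x₀ k
  · have h2 : (0 : ℝ) ≤ 2 / lamF := by positivity
    rw [mul_assoc, ENNReal.ofReal_mul h2]
    refine le_trans ?_ (mul_le_mul_right (hlin x₀ k) _)
    rw [expectOn_eq_expectEvent, expectOn_eq_expectEvent, ← expectEvent_const_mul]
    refine expectEvent_mono _ fun x => ?_
    rw [← ENNReal.ofReal_mul h2]
    exact ENNReal.ofReal_le_ofReal
      (norm_sub_sq_le_of_strongConvexOn (P.differentiable_obj hf) hlamF hF hmin x)
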